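/- Let $\Phi$ be a reduced irreducible crystallographic (finite) root system in a finite-dimensional real vector space, with Weyl group $W$. Fix a simple system $\Delta=\{\alpha_1,\dots,\alpha_n\}\subseteq\Phi$ (so that $n$ is the rank), with associated sets of positive and negative roots $\Phi^+$ and $\Phi^-=-\Phi^+$. For a root $\alpha=\sum_{i=1}^n a_i\alpha_i$ let $\mathrm{ht}(\alpha)=\sum_{i=1}^n a_i$ be its height. For $w\in W$ let $$N(w)=\{\alpha\in\Phi^+ \mid w^{-1}(\alpha)\in\Phi^-\}$$ be its inversion set, and define the atomic length of $w$ by $$\mathscr{L}(w)=\sum_{\alpha\in N(w)}\mathrm{ht}(\alpha).$$ Let $w_0$ be the longest element of $W$, that is, the element of maximal length with respect to the simple reflections. Then $\mathscr{L}$ maps $W$ into the integer interval $\{0,1,\dots,\mathscr{L}(w_0)\}$, and the map $$\mathscr{L}:W\longrightarrow\{0,1,\dots,\mathscr{L}(w_0)\}$$ is surjective if and only if $n\neq 2$. -/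

import Mathlib

namespace RootPairing.Base

variable {ι R M N : Type*} [CommRing R] [AddCommGroup M] [Module R M]
  [AddCommGroup N] [Module R N] {P : RootPairing ι R M N}

open Classical in
/-- The inversion set `N(w) = {α ∈ Φ⁺ | w⁻¹(α) ∈ Φ⁻}` of a Weyl group element `w`, relative to the
simple system `b`. A root is represented by its index in `ι`; every root that is
not positive is negative. -/
noncomputable def inversionSet [CharZero R] [Fintype ι] (b : P.Base) (w : P.weylGroup) :
    Finset ι :=
  {i : ι | b.IsPos i ∧ ¬ b.IsPos (w⁻¹ • i)}

/-- The atomic length `ℒ(w) = ∑ ht(α)`, the sum running over the inversions `α ∈ N(w)`. -/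
noncomputable def atomicLength [CharZero R] [Fintype ι] (b : P.Base) (w : P.weylGroup) : ℤ :=
  ∑ i ∈ b.inversionSet w, b.height i

/-- `w` is a product of `k` simple reflections. -/
def IsProdOfSimple (b : P.Base) (w : P.weylGroup) (k : ℕ) : Prop :=
  ∃ l : List b.support, l.length = k ∧ (l.map fun i : b.support ↦ weylGroup.ofIdx P (i : ι)).prod = w

/-- The simple reflections generate the Weyl group, so `length` is never a junk value. -/
theorem exists_isProdOfSimple {ι M N : Type*} [Finite ι]
    [AddCommGroup M] [Module ℝ M] [AddCommGroup N] [Module ℝ N] {P : RootPairing ι ℝ M N}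
    [P.IsCrystallographic] [P.IsReduced] (b : P.Base) (w : P.weylGroup) :
    ∃ k, b.IsProdOfSimple w k := by
  have hperm (i j : ι) : weylGroup.ofIdx P (P.reflectionPerm j i) =
      weylGroup.ofIdx P j * weylGroup.ofIdx P i * weylGroup.ofIdx P j := by
    apply Subtype.ext
    apply Equiv.weightHom_injective P
    ext x
    simp only [weylGroup.ofIdx, Subgroup.coe_mul, map_mul, Equiv.weightHom_apply,
      Equiv.reflection_weightEquiv, reflection_reflectionPerm, LinearEquiv.mul_apply]
  have key (i : ι) : ∃ k, b.IsProdOfSimple (weylGroup.ofIdx P i) k := by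
    refine b.induction_reflect i (p := fun i ↦ ∃ k, b.IsProdOfSimple (weylGroup.ofIdx P i) k)
      ?_ ?_ ?_
    · intro j hj
      rw [hperm]
      have : weylGroup.ofIdx P j * weylGroup.ofIdx P j = 1 := by
        rw [mul_eq_one_iff_inv_eq]
        exact Subtype.ext (Equiv.reflection_inv P j)
      rwa [this, one_mul]
    · intro j hj
      exact ⟨1, [⟨j, hj⟩], by simp, by simp⟩
    · rintro i j ⟨-, l, -, hl⟩ hj
      refine ⟨_, ⟨j, hj⟩ :: l ++ [⟨j, hj⟩], rfl, ?_⟩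
      rw [List.map_append, List.prod_append, List.map_cons, List.prod_cons, hl, hperm]
      simp
  obtain ⟨w, hw⟩ := w
  induction hw using weylGroup.induction with
  | mem i => exact key i
  | one => exact ⟨0, [], rfl, rfl⟩
  | mul x y hx hy h₁ h₂ =>
    obtain ⟨-, l₁, -, h₁⟩ := h₁
    obtain ⟨-, l₂, -, h₂⟩ := h₂
    refine ⟨_, l₁ ++ l₂, rfl, ?_⟩
    rw [List.map_append, List.prod_append, h₁, h₂]
    rfl

/-- The length `ℓ(w)`: the smallest `k` such that `w` is a product of `k` simple reflections. -/
noncomputable def length (b : P.Base) (w : P.weylGroup) : ℕ :=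
  sInf {k : ℕ | b.IsProdOfSimple w k}

/-- `w` is an element of maximal length. -/
def IsLongest (b : P.Base) (w : P.weylGroup) : Prop :=
  ∀ v : P.weylGroup, b.length v ≤ b.length w

/-- The Weyl group of a finite root system is finite, so an element of maximal length exists. -/
theorem exists_isLongest {ι M N : Type*} [Finite ι]
    [AddCommGroup M] [Module ℝ M] [AddCommGroup N] [Module ℝ N] {P : RootPairing ι ℝ M N}
    [P.IsRootSystem] (b : P.Base) : ∃ w : P.weylGroup, b.IsLongest w := by
  have hinj : Function.Injective P.weylGroupToPerm := by
    intro g h hgh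
    apply Subtype.ext
    apply Equiv.weightHom_injective P
    apply LinearEquiv.toLinearMap_injective
    refine LinearMap.ext_on_range (IsRootSystem.span_root_eq_top (P := P)) fun i ↦ ?_
    have hg := P.weylGroup_apply_root g i
    rw [hgh, ← P.weylGroup_apply_root h i] at hg
    exact hg
  have : Finite P.weylGroup := Finite.of_injective _ hinj
  exact Finite.exists_max b.length

end RootPairing.Base

/-! Let ρ be half the sum of the positive roots and ρ^∨ its dual, so that height is the pairing with
ρ^∨. Then ℒ(w) = ⟨ρ - wρ, ρ^∨⟩ (`two_mul_atomicLength`), and passing from w to s_i w changes ℒ by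
the height of the coroot w⁻¹α_i^∨ (`atomicLength_ofIdx_mul`).

For a set J of simple roots let L_J be the sum of the heights of the positive roots supported on J.
The parabolic subgroup W_J contains an element w_J inverting exactly these roots, and w ↦ w w_J
turns ℒ into L_J - ℒ (`exists_atomicLength_eq_sub`). Hence, if W_J attains all of [0, L_J] and J ⊆ K
with L_K ≤ 2 L_J + 1, then W_K attains all of [0, L_K] (`AttainsInterval.mono`). In types A, B, C
and D the sum L grows like the cube of the rank, so this inequality holds from a small rank on and
gives an induction. The initial and exceptional cases are settled by explicit walks in the Weyl
group, which by the same symmetry need to meet only one of z and L - z (`AttainsInterval.of_walk`).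

The case distinction is the classification of connected Cartan matrices of finite type
(`IsFiniteCartan.hasDynkin`): take a longest simply laced path in the diagram; a vertex attached to
it in a forbidden way produces an affine configuration, which a null vector rules out.

In rank two the value 2 is missed (`atomicLength_ne_two_of_card_eq_two`). Finally, an element of
maximal length inverts every positive root (`IsLongest.not_isPos`), so its atomic length is the full
sum L. -/

namespace RootPairing.Base

variable {ι M N : Type*} [AddCommGroup M] [Module ℝ M] [AddCommGroup N] [Module ℝ N]
  {P : RootPairing ι ℝ M N}

/-! ### Coefficients of roots with respect to a base -/

/-- The coefficient of the `i`-th root on the simple root `j`. -/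
noncomputable def coef (b : P.Base) (i : ι) (j : b.support) : ℤ :=
  (b.exists_root_eq_sum_int i).choose j

variable (b : P.Base)

lemma root_eq_sum_coef (i : ι) : P.root i = ∑ j, b.coef i j • P.root j := by
  conv_lhs => rw [(b.exists_root_eq_sum_int i).choose_spec.2.2]
  exact b.support.sum_subtype (by simp) _

lemma height_eq_sum_coef (i : ι) : b.height i = ∑ j, b.coef i j :=
  b.support.sum_subtype (by simp) _

variable {b} in
lemma coef_eq_of_root_eq_sum {i : ι} {f : b.support → ℤ} (h : P.root i = ∑ j, f j • P.root j)
    (j : b.support) : b.coef i j = f j :=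
  Fintype.linearIndependent_iffₛ.mp (b.linearIndepOn_root.restrict_scalars' ℤ) (b.coef i) f
    ((b.root_eq_sum_coef i).symm.trans h) j

lemma coef_self [DecidableEq b.support] (i j : b.support) : b.coef i j = if j = i then 1 else 0 :=
  coef_eq_of_root_eq_sum (f := fun j ↦ if j = i then 1 else 0) (by simp) j

variable {b} in
lemma IsPos.coef_nonneg {i : ι} (hi : b.IsPos i) (j : b.support) : 0 ≤ b.coef i j := by
  rcases (b.exists_root_eq_sum_int i).choose_spec.2.1 with h | h
  · exact h.le j
  · refine absurd hi (not_lt.mpr ?_)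
    rw [height_eq_sum_coef]
    exact Finset.sum_nonpos fun j _ ↦ h.le j

lemma coef_nonpos_of_not_isPos {i : ι} (hi : ¬ b.IsPos i) (j : b.support) : b.coef i j ≤ 0 := by
  rcases (b.exists_root_eq_sum_int i).choose_spec.2.1 with h | h
  · refine absurd (b.isPos_iff'.mpr ?_) hi
    rw [height_eq_sum_coef]
    exact Finset.sum_nonneg fun j _ ↦ h.le j
  · exact h.le j

lemma exists_coef_ne_zero (i : ι) : ∃ j, b.coef i j ≠ 0 := by
  by_contra! h
  exact b.height_ne_zero i (by simp [height_eq_sum_coef, h])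

section Crystallographic

variable [P.IsCrystallographic]

lemma pairingIn_eq_sum_coef (i k : ι) :
    P.pairingIn ℤ i k = ∑ j, b.coef i j * P.pairingIn ℤ j k := by
  apply FaithfulSMul.algebraMap_injective ℤ ℝ
  simp_rw [map_sum, map_mul, algebraMap_pairingIn, ← P.root_coroot'_eq_pairing]
  conv_lhs => rw [b.root_eq_sum_coef i]
  simp

lemma coef_reflectionPerm (i : ι) (j k : b.support) [DecidableEq b.support] :
    b.coef (P.reflectionPerm j i) k =
      b.coef i k - if k = j then P.pairingIn ℤ i j else 0 := by
  refine coef_eq_of_root_eq_sum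
    (f := fun k ↦ b.coef i k - if k = j then P.pairingIn ℤ i j else 0) ?_ k
  rw [root_reflectionPerm, reflection_apply_root' ℤ]
  simpa [sub_smul] using b.root_eq_sum_coef i

lemma height_reflectionPerm (i : ι) {j : ι} (hj : j ∈ b.support) :
    b.height (P.reflectionPerm j i) = b.height i - P.pairingIn ℤ i j := by
  have := P.reflection_apply_root' ℤ (i := j) (j := i)
  rw [← root_reflectionPerm, sub_eq_add_neg, ← neg_smul] at this
  rw [b.height_add_zsmul this, height_one_of_mem_support hj]
  simp [sub_eq_add_neg]

end Crystallographic

/-! ### The action of the Weyl group on the index set -/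

lemma root_smul_index (w : P.weylGroup) (i : ι) : P.root (w • i) = w • P.root i :=
  (P.weylGroup_apply_root w i).symm

lemma ofIdx_smul_index (i j : ι) : weylGroup.ofIdx P i • j = P.reflectionPerm i j := rfl

lemma smul_zsmul_weight (w : P.weylGroup) (z : ℤ) (x : M) : w • (z • x) = z • (w • x) :=
  map_zsmul (DistribSMul.toAddMonoidHom M w) z x

lemma root_smul_eq_sum (w : P.weylGroup) (i : ι) :
    P.root (w • i) = ∑ j, b.coef i j • P.root (w • (j : ι)) := by
  rw [root_smul_index]
  conv_lhs => rw [b.root_eq_sum_coef i]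
  rw [Finset.smul_sum]
  simp_rw [smul_zsmul_weight, root_smul_index]

lemma coef_smul_eq_sum (w : P.weylGroup) (i : ι) (k : b.support) :
    b.coef (w • i) k = ∑ j, b.coef i j * b.coef (w • (j : ι)) k := by
  refine coef_eq_of_root_eq_sum (f := fun k ↦ ∑ j, b.coef i j * b.coef (w • (j : ι)) k) ?_ k
  rw [b.root_smul_eq_sum]
  simp_rw [Finset.sum_smul, mul_smul]
  rw [Finset.sum_comm]
  refine Finset.sum_congr rfl fun j _ ↦ ?_
  rw [← Finset.smul_sum, ← root_eq_sum_coef]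

lemma height_smul_eq_sum (w : P.weylGroup) (i : ι) :
    b.height (w • i) = ∑ j, b.coef i j * b.height (w • (j : ι)) := by
  simp_rw [height_eq_sum_coef, b.coef_smul_eq_sum w i, Finset.mul_sum]
  exact Finset.sum_comm

lemma coroot_smul (w : P.weylGroup) (i : ι) :
    P.coroot (w⁻¹ • i) = (w : P.Aut).coweightMap (P.coroot i) :=
  (congr_fun (w : P.Aut).coroot_coweightMap i).symm

lemma pairing_smul_left (w : P.weylGroup) (i j : ι) :
    P.pairing (w • i) j = P.pairing i (w⁻¹ • j) := by
  have h := LinearMap.congr_fun (LinearMap.congr_fun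
    (w : P.Aut).weight_coweight_transpose (P.coroot j)) (P.root i)
  rw [← P.root_coroot_eq_pairing, ← P.root_coroot_eq_pairing, coroot_smul, root_smul_index]
  simpa using! h

end RootPairing.Base

namespace RootPairing.Base

variable {ι M N : Type*} [AddCommGroup M] [Module ℝ M] [AddCommGroup N] [Module ℝ N]
  {P : RootPairing ι ℝ M N} (b : P.Base)

lemma pairingIn_smul_left [P.IsCrystallographic] (w : P.weylGroup) (i j : ι) :
    P.pairingIn ℤ (w • i) j = P.pairingIn ℤ i (w⁻¹ • j) := by
  apply FaithfulSMul.algebraMap_injective ℤ ℝ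
  simp_rw [algebraMap_pairingIn, pairing_smul_left]

lemma ofIdx_inv (i : ι) : (weylGroup.ofIdx P i)⁻¹ = weylGroup.ofIdx P i :=
  Subtype.ext (Equiv.reflection_inv P i)

lemma smul_reflectionPerm_self (w : P.weylGroup) (i : ι) :
    w • P.reflectionPerm i i = P.reflectionPerm (w • i) (w • i) := by
  apply P.root.injective
  rw [root_smul_index, root_reflectionPerm, reflection_apply_self, root_reflectionPerm,
    reflection_apply_self, smul_neg, root_smul_index]

lemma height_reflectionPerm_self' (i : ι) : b.height (P.reflectionPerm i i) = - b.height i :=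
  b.height_reflectionPerm_self i

lemma isPos_reflectionPerm_self (i : ι) : b.IsPos (P.reflectionPerm i i) ↔ ¬ b.IsPos i :=
  IsPos.neg_iff_not b i

lemma reflectionPerm_self_injective : Function.Injective fun i ↦ P.reflectionPerm i i := by
  intro i j h
  have h' := congrArg P.root h
  simp only [root_reflectionPerm, reflection_apply_self, neg_inj] at h'
  exact P.root.injective h'

/-! ### The atomic length and the Weyl vector. -/

section Fintype

variable [Fintype ι]

lemma mem_inversionSet {w : P.weylGroup} {i : ι} :
    i ∈ b.inversionSet w ↔ b.IsPos i ∧ ¬ b.IsPos (w⁻¹ • i) := by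
  simp [inversionSet]

-- In terms of the Weyl vector this is 2ℒ(w) = ⟨2ρ - w(2ρ), ρ^∨⟩, the form in which ℒ becomes linear
-- in wρ.
open Classical in
lemma two_mul_atomicLength (w : P.weylGroup) :
    2 * b.atomicLength w = ∑ i with b.IsPos i, b.height i - ∑ i with b.IsPos i, b.height (w • i) := by
  have h1 : ∑ i with b.IsPos i, b.height (w • i) = ∑ i with b.IsPos (w⁻¹ • i), b.height i := by
    rw [Finset.sum_filter, Finset.sum_filter, ← Equiv.sum_comp (MulAction.toPerm w)
      fun i ↦ if b.IsPos (w⁻¹ • i) then b.height i else 0]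
    simp
  -- The sum of `g` over all roots is the difference of the two sides; it vanishes because `g` is
  -- odd under α ↦ -α.
  let g : ι → ℤ := fun i ↦ 2 * (if b.IsPos i ∧ ¬ b.IsPos (w⁻¹ • i) then b.height i else 0) -
    (if b.IsPos i then b.height i else 0) + (if b.IsPos (w⁻¹ • i) then b.height i else 0)
  have h2 : ∑ i, g i = 2 * b.atomicLength w -
      ∑ i with b.IsPos i, b.height i + ∑ i with b.IsPos (w⁻¹ • i), b.height i := by
    simp only [g, Finset.sum_add_distrib, Finset.sum_sub_distrib, ← Finset.mul_sum,
      ← Finset.sum_filter]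
    rfl
  have h3 : ∑ i, g i = 0 := by
    have h4 : ∑ i, g (P.reflectionPerm i i) = ∑ i, g i :=
      Equiv.sum_comp (Equiv.ofBijective _ reflectionPerm_self_injective.bijective_of_finite) g
    have h5 : ∀ i, g (P.reflectionPerm i i) = - g i := by
      intro i
      simp only [g, smul_reflectionPerm_self, isPos_reflectionPerm_self,
        height_reflectionPerm_self']
      by_cases h : b.IsPos i <;> by_cases h' : b.IsPos (w⁻¹ • i) <;> simp [h, h'] <;> ring
    simp only [h5, Finset.sum_neg_distrib] at h4
    linarith
  rw [h1]
  linarith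

variable [P.IsCrystallographic]

open Classical in
/-- The positive roots which are combinations of simple roots in `J`. -/
noncomputable def posRoots (J : Finset b.support) : Finset ι :=
  {i | b.IsPos i ∧ ∀ j ∉ J, b.coef i j = 0}

omit [P.IsCrystallographic] in
lemma mem_posRoots {J : Finset b.support} {i : ι} :
    i ∈ b.posRoots J ↔ b.IsPos i ∧ ∀ j ∉ J, b.coef i j = 0 := by
  simp [posRoots]

variable [P.IsReduced]

/-- The reflection s_j permutes the positive roots of J other than α_j and negates the pairing with
α_j^∨, so only ⟨α_j, α_j^∨⟩ survives. -/
lemma sum_pairingIn_posRoots {J : Finset b.support} {j : b.support} (hj : j ∈ J) :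
    ∑ k ∈ b.posRoots J, P.pairingIn ℤ k j = 2 := by
  classical
  have hjm : (j : ι) ∈ b.posRoots J := b.mem_posRoots.mpr
    ⟨isPos_of_mem_support j.2, fun k hk ↦ by
      rw [coef_self, if_neg]; rintro rfl; exact hk hj⟩
  rw [← Finset.add_sum_erase _ _ hjm]
  have h : ∑ k ∈ (b.posRoots J).erase j, P.pairingIn ℤ k j =
      ∑ k ∈ (b.posRoots J).erase j, -P.pairingIn ℤ k j := by
    refine Finset.sum_bij' (fun k _ ↦ P.reflectionPerm j k) (fun k _ ↦ P.reflectionPerm j k)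
      ?_ ?_ (by simp) (by simp) (by simp [← pairingIn_reflectionPerm])
    all_goals
      intro k hk
      simp only [Finset.mem_erase, mem_posRoots] at hk ⊢
      refine ⟨fun h ↦ ?_, hk.2.1.reflectionPerm j.2 hk.1, fun l hl ↦ ?_⟩
      · have : k = P.reflectionPerm j j := by
          simpa using congrArg (P.reflectionPerm (j : ι)) h
        have := (b.isPos_reflectionPerm_self j).mp (this ▸ hk.2.1)
        exact this (isPos_of_mem_support j.2)
      · rw [coef_reflectionPerm, if_neg (by rintro rfl; exact hl hj), hk.2.2 l hl, sub_zero]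
  rw [Finset.sum_neg_distrib] at h
  have : P.pairingIn ℤ (j : ι) j = 2 := by simp
  linarith

omit [P.IsCrystallographic] [P.IsReduced] in
open Classical in
lemma posRoots_univ : b.posRoots Finset.univ = Finset.univ.filter b.IsPos := by
  ext; simp [mem_posRoots]

open Classical in
lemma sum_pairingIn_isPos (i : ι) :
    ∑ k with b.IsPos k, P.pairingIn ℤ k i = 2 * b.flip.height i := by
  have h (k : ι) : P.pairingIn ℤ k i = ∑ j : b.support, b.flip.coef i j * P.pairingIn ℤ k j :=
    b.flip.pairingIn_eq_sum_coef i k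
  simp_rw [h]
  rw [Finset.sum_comm]
  simp_rw [← Finset.mul_sum, ← posRoots_univ, b.sum_pairingIn_posRoots (Finset.mem_univ _)]
  rw [height_eq_sum_coef, Finset.mul_sum]
  exact Finset.sum_congr rfl fun j _ ↦ mul_comm _ _

/-- Reflecting wβ in α_i lowers its height by ⟨β, w⁻¹α_i^∨⟩; summed over β > 0 this is ⟨2ρ,
w⁻¹α_i^∨⟩, twice a coroot height. -/
lemma atomicLength_ofIdx_mul (w : P.weylGroup) (i : b.support) :
    b.atomicLength (weylGroup.ofIdx P (i : ι) * w) =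
      b.atomicLength w + b.flip.height (w⁻¹ • (i : ι)) := by
  classical
  have h1 := b.two_mul_atomicLength w
  have h2 := b.two_mul_atomicLength (weylGroup.ofIdx P (i : ι) * w)
  have h3 := b.sum_pairingIn_isPos (w⁻¹ • (i : ι))
  simp_rw [mul_smul, ofIdx_smul_index, b.height_reflectionPerm _ i.2, pairingIn_smul_left] at h2
  rw [Finset.sum_sub_distrib, h3] at h2
  linarith

-- These heights are the coordinates ⟨wρ, α_j^∨⟩ of wρ. They are updated by the Cartan matrix alone,
-- so a walk can be followed numerically.
omit [Fintype ι] [P.IsReduced] in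
lemma flip_height_ofIdx_mul (w : P.weylGroup) (i j : b.support) :
    b.flip.height ((weylGroup.ofIdx P (i : ι) * w)⁻¹ • (j : ι)) =
      b.flip.height (w⁻¹ • (j : ι)) - P.pairingIn ℤ i j * b.flip.height (w⁻¹ • (i : ι)) := by
  have h : P.flip.root ((weylGroup.ofIdx P (i : ι) * w)⁻¹ • (j : ι)) =
      P.flip.root (w⁻¹ • (j : ι)) + (-P.pairingIn ℤ i j) • P.flip.root (w⁻¹ • (i : ι)) := by
    change P.coroot _ = P.coroot _ + _ • P.coroot _
    rw [mul_inv_rev, mul_smul, ofIdx_inv, ofIdx_smul_index, coroot_smul, coroot_smul, coroot_smul,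
      P.coroot_reflectionPerm, coreflection_apply_coroot, map_sub, map_smul,
      ← P.algebraMap_pairingIn ℤ]
    simp [sub_eq_add_neg, Int.cast_smul_eq_zsmul]
  rw [b.flip.height_add_zsmul h, smul_eq_mul]
  ring

omit [P.IsCrystallographic] [P.IsReduced] in
lemma atomicLength_one : b.atomicLength 1 = 0 := by
  simp [atomicLength, inversionSet]

lemma flip_isPos_of_isPos {i : ι} (hi : b.IsPos i) : b.flip.IsPos i := by
  suffices ∀ k, b.IsPos k → b.IsPos k → b.flip.IsPos k from this i hi hi
  intro k hk
  -- The predicate is conditional on positivity because the induction may pass through negative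
  -- roots. The reflection s_j changes the sign only of ±α_j, so that case is harmless.
  refine hk.induction_on_reflect (p := fun k ↦ b.IsPos k → b.flip.IsPos k)
    (fun k hk _ ↦ isPos_of_mem_support (b := b.flip) hk) ?_
  intro k j hkj hj hpos
  by_cases hk : b.IsPos k
  · refine (hkj hk).reflectionPerm hj ?_
    rintro rfl
    exact (b.isPos_reflectionPerm_self k).mp hpos hk
  · by_cases hkj' : P.reflectionPerm k k = j
    · have hk' : k = P.reflectionPerm j j := by
        rw [← P.root_eq_neg_iff, ← hkj', root_reflectionPerm, reflection_apply_self, neg_neg]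
      have : P.reflectionPerm j k = j := by
        rw [hk', reflectionPerm_self]
      rw [this]
      exact isPos_of_mem_support (b := b.flip) hj
    · have h := ((b.isPos_reflectionPerm_self k).mpr hk).reflectionPerm hj hkj'
      have h' : P.reflectionPerm j (P.reflectionPerm k k) =
          P.reflectionPerm (P.reflectionPerm j k) (P.reflectionPerm j k) := by
        apply P.root.injective
        rw [root_reflectionPerm, root_reflectionPerm, reflection_apply_self, root_reflectionPerm,
          reflection_apply_self, root_reflectionPerm, map_neg]
      rw [h', isPos_reflectionPerm_self] at h
      exact absurd hpos h

end Fintype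

end RootPairing.Base

namespace RootPairing.Base

variable {ι M N : Type*} [Fintype ι] [AddCommGroup M] [Module ℝ M] [AddCommGroup N] [Module ℝ N]
  {P : RootPairing ι ℝ M N} (b : P.Base)

/-! ### Parabolic subgroups -/

/-- The subgroup generated by the simple reflections in `J`. -/
noncomputable def parabolicWeyl (J : Finset b.support) : Subgroup P.weylGroup :=
  Subgroup.closure ((fun j : b.support ↦ weylGroup.ofIdx P (j : ι)) '' J)

omit [Fintype ι] in
lemma ofIdx_mem_parabolicWeyl {J : Finset b.support} {j : b.support} (hj : j ∈ J) :
    weylGroup.ofIdx P (j : ι) ∈ b.parabolicWeyl J :=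
  Subgroup.subset_closure ⟨j, hj, rfl⟩

omit [Fintype ι] in
lemma parabolicWeyl_mono {J K : Finset b.support} (h : J ⊆ K) :
    b.parabolicWeyl J ≤ b.parabolicWeyl K :=
  Subgroup.closure_mono (Set.image_mono h)

/-- The sum of the heights of the positive roots which are combinations of simple roots in `J`. -/
noncomputable def heightSum (J : Finset b.support) : ℤ := ∑ i ∈ b.posRoots J, b.height i

/-- Every integer between `0` and `b.heightSum J` is the atomic length of an element of the
parabolic subgroup of `J`. -/
def AttainsInterval (J : Finset b.support) : Prop :=
  ∀ z, 0 ≤ z → z ≤ b.heightSum J → ∃ w ∈ b.parabolicWeyl J, b.atomicLength w = z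

omit [Fintype ι] in
lemma isPos_smul_or {w : P.weylGroup} {i : ι} :
    b.IsPos (w • P.reflectionPerm i i) ↔ ¬ b.IsPos (w • i) := by
  rw [smul_reflectionPerm_self, isPos_reflectionPerm_self]

lemma atomicLength_nonneg (w : P.weylGroup) : 0 ≤ b.atomicLength w :=
  Finset.sum_nonneg fun _ hi ↦ (b.mem_inversionSet.mp hi).1.le

variable [P.IsCrystallographic]

omit [Fintype ι] in
lemma coef_smul_of_mem_parabolicWeyl {J : Finset b.support} {w : P.weylGroup}
    (hw : w ∈ b.parabolicWeyl J) (i : ι) {k : b.support} (hk : k ∉ J) :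
    b.coef (w • i) k = b.coef i k := by
  classical
  induction hw using Subgroup.closure_induction generalizing i with
  | mem x hx =>
    obtain ⟨j, hj, rfl⟩ := hx
    rw [ofIdx_smul_index, coef_reflectionPerm, if_neg (by rintro rfl; exact hk hj), sub_zero]
  | one => rw [one_smul]
  | mul x y _ _ hx hy => rw [mul_smul, hx, hy]
  | inv x _ hx => rw [← hx, smul_inv_smul]

/-- Elements of W_J do not change coefficients outside J. For an inversion such a coefficient is
both ≥ 0 and ≤ 0. -/
lemma inversionSet_subset_posRoots {J : Finset b.support} {w : P.weylGroup}
    (hw : w ∈ b.parabolicWeyl J) : b.inversionSet w ⊆ b.posRoots J := by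
  intro i hi
  rw [mem_inversionSet] at hi
  refine b.mem_posRoots.mpr ⟨hi.1, fun j hj ↦ le_antisymm ?_ (hi.1.coef_nonneg j)⟩
  rw [← b.coef_smul_of_mem_parabolicWeyl (inv_mem hw) i hj]
  exact b.coef_nonpos_of_not_isPos hi.2 j

lemma atomicLength_le_heightSum {J : Finset b.support} {w : P.weylGroup}
    (hw : w ∈ b.parabolicWeyl J) : b.atomicLength w ≤ b.heightSum J :=
  Finset.sum_le_sum_of_subset_of_nonneg (b.inversionSet_subset_posRoots hw)
    fun _ hi _ ↦ (b.mem_posRoots.mp hi).1.le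

omit [P.IsCrystallographic] in
lemma not_isPos_smul_of_mem_posRoots {J : Finset b.support} {w : P.weylGroup}
    (hw : ∀ j ∈ J, ¬ b.IsPos (w • (j : ι))) {i : ι} (hi : i ∈ b.posRoots J) :
    ¬ b.IsPos (w • i) := by
  rw [mem_posRoots] at hi
  rw [isPos_iff', not_le, height_smul_eq_sum]
  have hneg (j : b.support) (hj : j ∈ J) : b.height (w • (j : ι)) < 0 := by
    have := hw j hj
    rwa [isPos_iff', not_le] at this
  refine Finset.sum_neg' (fun j _ ↦ ?_) ?_
  · by_cases hj : j ∈ J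
    · exact mul_nonpos_of_nonneg_of_nonpos (hi.1.coef_nonneg j) (hneg j hj).le
    · simp [hi.2 j hj]
  · obtain ⟨j, hj⟩ := b.exists_coef_ne_zero i
    have hjJ : j ∈ J := by
      by_contra h
      exact hj (hi.2 j h)
    exact ⟨j, Finset.mem_univ _,
      mul_neg_of_pos_of_neg (lt_of_le_of_ne (hi.1.coef_nonneg j) hj.symm) (hneg j hjJ)⟩

variable [P.IsReduced]

/-- This is w_J, found as a maximizer of ℒ on W_J: if w⁻¹α_j were positive for some j in J, its
coroot would have positive height and s_j w would have larger atomic length. -/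
lemma exists_inversionSet_eq_posRoots (J : Finset b.support) :
    ∃ w ∈ b.parabolicWeyl J, b.inversionSet w = b.posRoots J := by
  obtain ⟨z, ⟨w, hw, rfl⟩, hz⟩ := Int.exists_greatest_of_bdd
    (P := fun z ↦ ∃ w ∈ b.parabolicWeyl J, b.atomicLength w = z)
    ⟨b.heightSum J, by rintro _ ⟨w, hw, rfl⟩; exact b.atomicLength_le_heightSum hw⟩
    ⟨0, 1, one_mem _, b.atomicLength_one⟩
  refine ⟨w, hw, (b.inversionSet_subset_posRoots hw).antisymm fun i hi ↦ ?_⟩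
  refine b.mem_inversionSet.mpr ⟨(b.mem_posRoots.mp hi).1,
    b.not_isPos_smul_of_mem_posRoots (fun j hj hpos ↦ ?_) hi⟩
  have h := hz _ ⟨_, mul_mem (b.ofIdx_mem_parabolicWeyl hj) hw, rfl⟩
  rw [atomicLength_ofIdx_mul] at h
  have := b.flip_isPos_of_isPos hpos
  rw [isPos_iff] at this
  linarith

/-- Right multiplication by the longest element of a parabolic subgroup complements inversions. -/
lemma exists_atomicLength_eq_sub {J : Finset b.support} {w : P.weylGroup}
    (hw : w ∈ b.parabolicWeyl J) :
    ∃ v ∈ b.parabolicWeyl J, b.atomicLength v = b.heightSum J - b.atomicLength w := by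
  classical
  obtain ⟨u, hu, hu'⟩ := b.exists_inversionSet_eq_posRoots J
  refine ⟨w * u, mul_mem hw hu, ?_⟩
  -- The inverse of w_J flips the sign of every root supported on J, and w⁻¹ preserves such roots;
  -- hence N(w w_J) is the complement of N(w).
  have hupos (i : ι) (hi : ∀ j ∉ J, b.coef i j = 0) : b.IsPos (u⁻¹ • i) ↔ ¬ b.IsPos i := by
    have key (i : ι) (hi : ∀ j ∉ J, b.coef i j = 0) (hpos : b.IsPos i) : ¬ b.IsPos (u⁻¹ • i) := by
      have : i ∈ b.inversionSet u := hu' ▸ b.mem_posRoots.mpr ⟨hpos, hi⟩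
      exact (b.mem_inversionSet.mp this).2
    refine ⟨fun h h' ↦ key i hi h' h, fun h ↦ ?_⟩
    have h1 := key (P.reflectionPerm i i) (fun j hj ↦ ?_) ((b.isPos_reflectionPerm_self i).mpr h)
    · rwa [isPos_smul_or, not_not] at h1
    · rw [coef_eq_of_root_eq_sum (f := fun j ↦ - b.coef i j)]
      · simp [hi j hj]
      · rw [root_reflectionPerm, reflection_apply_self]
        conv_lhs => rw [b.root_eq_sum_coef]
        simp
  have hsd : b.inversionSet (w * u) = b.posRoots J \ b.inversionSet w := by
    ext i
    simp only [Finset.mem_sdiff, mem_inversionSet, not_and, not_not]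
    have hs := b.inversionSet_subset_posRoots (mul_mem hw hu)
    have aux (hi : i ∈ b.posRoots J) : b.IsPos ((w * u)⁻¹ • i) ↔ ¬ b.IsPos (w⁻¹ • i) := by
      rw [mul_inv_rev, mul_smul]
      refine hupos _ fun j hj ↦ ?_
      rw [b.coef_smul_of_mem_parabolicWeyl (inv_mem hw) i hj]
      exact (b.mem_posRoots.mp hi).2 j hj
    constructor
    · intro h
      have hi := hs (b.mem_inversionSet.mpr h)
      refine ⟨hi, fun _ ↦ ?_⟩
      have := h.2
      rwa [aux hi, not_not] at this
    · rintro ⟨hi, h⟩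
      have hp := (b.mem_posRoots.mp hi).1
      refine ⟨hp, ?_⟩
      rw [aux hi, not_not]
      exact h hp
  rw [atomicLength, hsd, heightSum, atomicLength, eq_sub_iff_add_eq,
    Finset.sum_sdiff (b.inversionSet_subset_posRoots hw)]

/-- Values up to L_J come from W_J. For z > L_J the mirror value L_K - z is at most L_J, and
complementing in W_K brings it back to z. -/
lemma AttainsInterval.mono {J K : Finset b.support} (hJ : b.AttainsInterval J) (hJK : J ⊆ K)
    (h : b.heightSum K ≤ 2 * b.heightSum J + 1) : b.AttainsInterval K := by
  intro z hz hzK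
  by_cases hzJ : z ≤ b.heightSum J
  · obtain ⟨w, hw, hw'⟩ := hJ z hz hzJ
    exact ⟨w, b.parabolicWeyl_mono hJK hw, hw'⟩
  · obtain ⟨w, hw, hw'⟩ := hJ (b.heightSum K - z) (by linarith) (by linarith)
    obtain ⟨v, hv, hv'⟩ := b.exists_atomicLength_eq_sub (b.parabolicWeyl_mono hJK hw)
    exact ⟨v, hv, by linarith⟩

/-- If the vector `c` supported on `J` pairs to `2k` with every simple coroot of `J`, it is `k`
times the sum of the positive roots of `J`. -/
lemma mul_heightSum_eq [P.IsRootSystem] {J : Finset b.support} {c : b.support → ℤ} {k : ℤ}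
    (h : ∀ j ∈ J, ∑ i ∈ J, c i * P.pairingIn ℤ i j = 2 * k) :
    k * b.heightSum J = ∑ j ∈ J, c j := by
  classical
  let F : b.support → ℤ := fun j ↦ ∑ i ∈ b.posRoots J, b.coef i j
  have hF0 (j : b.support) (hj : j ∉ J) : F j = 0 :=
    Finset.sum_eq_zero fun i hi ↦ (b.mem_posRoots.mp hi).2 j hj
  have hF (j : b.support) (hj : j ∈ J) : ∑ i, F i * P.pairingIn ℤ i j = 2 := by
    rw [← b.sum_pairingIn_posRoots hj,
      Finset.sum_congr rfl fun k _ ↦ b.pairingIn_eq_sum_coef k (j : ι)]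
    simp_rw [F, Finset.sum_mul]
    exact Finset.sum_comm
  have hL : b.heightSum J = ∑ j ∈ J, F j := by
    rw [heightSum, Finset.sum_subset (Finset.subset_univ J) fun j _ hj ↦ hF0 j hj]
    simp_rw [height_eq_sum_coef, F]
    exact Finset.sum_comm
  -- The difference between k times the sum of the positive roots of J and c. It is orthogonal to
  -- the simple coroots of J and supported on J, hence zero by positive definiteness of the
  -- symmetrized Cartan matrix.
  let x : b.support → ℤ := fun j ↦ if j ∈ J then k * F j - c j else 0
  have hx : x = 0 := by
    obtain ⟨d, -, hd⟩ := b.exists_cartanMatrix_mul_diagaonal_posDef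
    by_contra hx
    refine absurd (hd.dotProduct_mulVec_pos hx) (not_lt.mpr (le_of_eq ?_))
    rw [← Matrix.mulVec_mulVec, Matrix.dotProduct_mulVec, dotProduct]
    refine Finset.sum_eq_zero fun j _ ↦ ?_
    rw [Matrix.mulVec_diagonal]
    by_cases hj : j ∈ J
    · have : Matrix.vecMul (star x) b.cartanMatrix j = 0 := by
        have h1 := hF j hj
        rw [← Finset.sum_subset (Finset.subset_univ J)
          (fun i _ hi ↦ by rw [hF0 i hi, zero_mul])] at h1
        have h2 := h j hj
        rw [Matrix.vecMul, dotProduct, ← Finset.sum_subset (Finset.subset_univ J)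
          (fun i _ hi ↦ by simp [x, hi])]
        calc _ = ∑ i ∈ J, (k * (F i * P.pairingIn ℤ i j) - c i * P.pairingIn ℤ i j) :=
              Finset.sum_congr rfl fun i hi ↦ by
                simp only [Pi.star_apply, star_trivial, x, if_pos hi, cartanMatrixIn_def]; ring
          _ = 0 := by rw [Finset.sum_sub_distrib, ← Finset.mul_sum, h1, h2]; ring
      rw [this, zero_mul]
    · simp [x, hj]
  rw [hL, Finset.mul_sum]
  refine Finset.sum_congr rfl fun j hj ↦ ?_
  have := congrFun hx j
  simp only [x, if_pos hj, Pi.zero_apply] at this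
  linarith

end RootPairing.Base

namespace RootPairing.Base

variable {ι M N : Type*} [Fintype ι] [AddCommGroup M] [Module ℝ M] [AddCommGroup N] [Module ℝ N]
  {P : RootPairing ι ℝ M N} (b : P.Base)

/-! ### The longest element -/

omit [Fintype ι] in
lemma ofIdx_smul_eq_conj (w : P.weylGroup) (i : ι) :
    weylGroup.ofIdx P (w • i) = w * weylGroup.ofIdx P i * w⁻¹ := by
  have hperm (i j : ι) : weylGroup.ofIdx P (P.reflectionPerm j i) =
      weylGroup.ofIdx P j * weylGroup.ofIdx P i * weylGroup.ofIdx P j := by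
    apply Subtype.ext
    apply Equiv.weightHom_injective P
    ext x
    simp only [weylGroup.ofIdx, Subgroup.coe_mul, map_mul, Equiv.weightHom_apply,
      Equiv.reflection_weightEquiv, reflection_reflectionPerm, LinearEquiv.mul_apply]
  have hmul (x y : P.weylGroup)
      (hx : ∀ i, weylGroup.ofIdx P (x • i) = x * weylGroup.ofIdx P i * x⁻¹)
      (hy : ∀ i, weylGroup.ofIdx P (y • i) = y * weylGroup.ofIdx P i * y⁻¹) (i : ι) :
      weylGroup.ofIdx P ((x * y) • i) = x * y * weylGroup.ofIdx P i * (x * y)⁻¹ := by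
    rw [mul_smul, hx, hy]
    group
  obtain ⟨w, hw⟩ := w
  induction hw using weylGroup.induction generalizing i with
  | mem j =>
    change weylGroup.ofIdx P (P.reflectionPerm j i) =
      weylGroup.ofIdx P j * weylGroup.ofIdx P i * (weylGroup.ofIdx P j)⁻¹
    rw [hperm, ofIdx_inv]
  | one =>
    change weylGroup.ofIdx P i = 1 * weylGroup.ofIdx P i * 1⁻¹
    group
  | mul x y hx hy h₁ h₂ => exact hmul ⟨x, hx⟩ ⟨y, hy⟩ h₁ h₂ i

variable [P.IsCrystallographic] [P.IsReduced]

/-- The deletion property of the Weyl group. -/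
lemma exists_deletion (l : List b.support) (i : b.support)
    (h : ¬ b.IsPos ((l.map fun i : b.support ↦ weylGroup.ofIdx P (i : ι)).prod⁻¹ • (i : ι))) :
    ∃ l' : List b.support, l'.length + 1 = l.length ∧
      (l'.map fun i : b.support ↦ weylGroup.ofIdx P (i : ι)).prod =
        weylGroup.ofIdx P (i : ι) * (l.map fun i : b.support ↦ weylGroup.ofIdx P (i : ι)).prod := by
  induction l using List.reverseRecOn with
  | nil => exact absurd (by simpa using isPos_of_mem_support i.2) h
  | append_singleton t a ih =>
    set u := (t.map fun i : b.support ↦ weylGroup.ofIdx P (i : ι)).prod with hu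
    rw [List.map_append, List.prod_append, ← hu, List.map_singleton, List.prod_singleton] at h ⊢
    by_cases hpos : b.IsPos (u⁻¹ • (i : ι))
    -- The last letter a makes a positive root negative, and α_a is the only positive root that s_a
    -- makes negative. Thus s_i = u s_a u⁻¹ and the letter cancels.
    · have ha : u⁻¹ • (i : ι) = a := by
        by_contra hne
        refine h ?_
        rw [mul_inv_rev, mul_smul, ofIdx_inv, ofIdx_smul_index]
        exact hpos.reflectionPerm a.2 hne
      refine ⟨t, by simp, ?_⟩
      have hi : (i : ι) = u • (a : ι) := by rw [← ha, smul_inv_smul]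
      have haa : weylGroup.ofIdx P (a : ι) * weylGroup.ofIdx P (a : ι) = 1 := by
        nth_rw 1 [← ofIdx_inv]
        exact inv_mul_cancel _
      rw [hi, ofIdx_smul_eq_conj, ← hu]
      simp [mul_assoc, haa]
    · obtain ⟨t', ht', ht⟩ := ih hpos
      refine ⟨t' ++ [a], by simpa using ht', ?_⟩
      rw [List.map_append, List.prod_append, ht, mul_assoc]
      simp

-- If w⁻¹α_j were positive, deletion applied to a shortest word for s_j w would give a word for w
-- with one letter less, so s_j w would be longer than w.
variable {b} in
lemma IsLongest.not_isPos {w : P.weylGroup} (hw : b.IsLongest w) (j : b.support) :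
    ¬ b.IsPos (w⁻¹ • (j : ι)) := by
  intro hpos
  obtain ⟨l, hl, hl'⟩ : b.IsProdOfSimple (weylGroup.ofIdx P (j : ι) * w)
    (b.length (weylGroup.ofIdx P (j : ι) * w)) := Nat.sInf_mem (b.exists_isProdOfSimple _)
  obtain ⟨l', h1, h2⟩ := b.exists_deletion l j (by
    rw [hl', mul_inv_rev, mul_smul, ofIdx_inv, ofIdx_smul_index, isPos_smul_or, not_not]
    exact hpos)
  have hjj : weylGroup.ofIdx P (j : ι) * weylGroup.ofIdx P (j : ι) = 1 := by
    nth_rw 1 [← ofIdx_inv]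
    exact inv_mul_cancel _
  rw [hl', ← mul_assoc, hjj, one_mul] at h2
  have h3 : b.length w ≤ l'.length := Nat.sInf_le ⟨l', rfl, h2⟩
  have h4 := hw (weylGroup.ofIdx P (j : ι) * w)
  lia

variable {b} in
lemma IsLongest.inversionSet_eq {w : P.weylGroup} (hw : b.IsLongest w) :
    b.inversionSet w = b.posRoots Finset.univ := by
  ext i
  refine ⟨fun hi ↦ b.mem_posRoots.mpr ⟨(b.mem_inversionSet.mp hi).1, by simp⟩, fun hi ↦ ?_⟩
  exact b.mem_inversionSet.mpr ⟨(b.mem_posRoots.mp hi).1,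
    b.not_isPos_smul_of_mem_posRoots (fun j _ ↦ hw.not_isPos j) hi⟩

variable {b} in
lemma IsLongest.atomicLength_eq {w : P.weylGroup} (hw : b.IsLongest w) :
    b.atomicLength w = b.heightSum Finset.univ := by
  rw [atomicLength, hw.inversionSet_eq, heightSum]

omit [P.IsCrystallographic] [P.IsReduced] in
lemma atomicLength_le_heightSum_univ (w : P.weylGroup) :
    b.atomicLength w ≤ b.heightSum Finset.univ :=
  Finset.sum_le_sum_of_subset_of_nonneg
    (fun i hi ↦ b.mem_posRoots.mpr ⟨(b.mem_inversionSet.mp hi).1, by simp⟩)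
    fun _ hi _ ↦ (b.mem_posRoots.mp hi).1.le

/-! ### Rank two -/

omit [Fintype ι] [P.IsCrystallographic] [P.IsReduced] in
lemma two_le_height {i : ι} (hi : b.IsPos i) (hi' : i ∉ b.support) : 2 ≤ b.height i := by
  classical
  by_contra! h
  have h1 : b.height i = 1 := by
    have := b.isPos_iff.mp hi
    lia
  obtain ⟨j, hj⟩ := b.exists_coef_ne_zero i
  have hj1 : 0 < b.coef i j := lt_of_le_of_ne (hi.coef_nonneg j) hj.symm
  have hsum := b.height_eq_sum_coef i
  rw [h1, ← Finset.add_sum_erase _ _ (Finset.mem_univ j)] at hsum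
  have h0 : 0 ≤ ∑ k ∈ Finset.univ.erase j, b.coef i k :=
    Finset.sum_nonneg fun k _ ↦ hi.coef_nonneg k
  have hz := (Finset.sum_eq_zero_iff_of_nonneg fun k _ ↦ hi.coef_nonneg k).mp
    (show ∑ k ∈ Finset.univ.erase j, b.coef i k = 0 by lia)
  have : P.root i = P.root j := by
    rw [b.root_eq_sum_coef i, Finset.sum_eq_single j, show b.coef i j = 1 by lia, one_smul]
    · intro k _ hk
      rw [hz k (by simp [hk]), zero_smul]
    · simp
  exact hi' (P.root.injective this ▸ j.2)

/-- In an irreducible root system of rank two no atomic length is equal to `2`. -/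
lemma atomicLength_ne_two_of_card_eq_two [P.IsRootSystem] [P.IsIrreducible]
    (h2 : b.support.card = 2) (w : P.weylGroup) : b.atomicLength w ≠ 2 := by
  classical
  intro hw
  have hpos : ∀ i ∈ b.inversionSet w, 0 ≤ b.height i :=
    fun i hi ↦ (b.mem_inversionSet.mp hi).1.le
  -- If w⁻¹ kept all simple roots positive it would keep all positive roots positive, and ℒ(w) would
  -- be 0.
  have hsimple : ∃ j : b.support, ¬ b.IsPos (w⁻¹ • (j : ι)) := by
    by_contra! h
    have : b.inversionSet w = ∅ := by
      rw [Finset.eq_empty_iff_forall_notMem]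
      intro i hi
      rw [mem_inversionSet, isPos_iff' (i := w⁻¹ • i), height_smul_eq_sum] at hi
      exact hi.2 (Finset.sum_nonneg fun j _ ↦ mul_nonneg (hi.1.coef_nonneg j) (h j).le)
    simp [atomicLength, this] at hw
  obtain ⟨j, hj⟩ := hsimple
  have hjN : (j : ι) ∈ b.inversionSet w :=
    b.mem_inversionSet.mpr ⟨isPos_of_mem_support j.2, hj⟩
  have hsum : b.height j + ∑ i ∈ (b.inversionSet w).erase j, b.height i = 2 := by
    rw [Finset.add_sum_erase _ _ hjN]; exact hw
  rw [height_one_of_mem_support j.2] at hsum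
  -- The remaining heights add up to 1, so the next inversion is the other simple root. Then every
  -- positive root is an inversion.
  obtain ⟨k, hk⟩ : ((b.inversionSet w).erase j).Nonempty := by
    rw [Finset.nonempty_iff_ne_empty]
    intro h
    simp [h] at hsum
  have hksum := Finset.add_sum_erase _ b.height hk
  have hrest : 0 ≤ ∑ i ∈ ((b.inversionSet w).erase j).erase k, b.height i :=
    Finset.sum_nonneg fun i hi ↦ hpos i (Finset.mem_of_mem_erase (Finset.mem_of_mem_erase hi))
  have hkN := Finset.mem_of_mem_erase hk
  have hkj := Finset.ne_of_mem_erase hk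
  have hks : k ∈ b.support := by
    by_contra hks
    have := b.two_le_height (b.mem_inversionSet.mp hkN).1 hks
    lia
  have hsupp : b.support = {(j : ι), k} :=
    (Finset.eq_of_subset_of_card_le (by simp [Finset.insert_subset_iff, hks])
      (by rw [h2, Finset.card_pair hkj.symm])).symm
  have hall (i : b.support) : ¬ b.IsPos (w⁻¹ • (i : ι)) := by
    obtain ⟨i, hi⟩ := i
    have : i = j ∨ i = k := by simpa using (Finset.ext_iff.mp hsupp i).mp hi
    rcases this with rfl | rfl
    · exact hj
    · exact (b.mem_inversionSet.mp hkN).2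
  -- Otherwise {α_j} alone would be closed under adjacency, against irreducibility.
  have hA : b.cartanMatrix ⟨k, hks⟩ j ≠ 0 := by
    intro h0
    have := b.induction_on_cartanMatrix (fun i ↦ i = j) (j := ⟨k, hks⟩) rfl (by
      rintro i ⟨l, hl⟩ rfl hne
      have : l = i ∨ l = k := by simpa using (Finset.ext_iff.mp hsupp l).mp hl
      rcases this with rfl | rfl
      · rfl
      · exact absurd h0 hne)
    exact hkj (congrArg Subtype.val this)
  have hAneg : P.pairingIn ℤ k j < 0 :=
    lt_of_le_of_ne (b.pairingIn_le_zero_of_ne hkj hks j.2) hA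
  -- The root s_j(α_k) has height at least 2 and is a third inversion, so ℒ(w) would be at least 4.
  let r := P.reflectionPerm j k
  have hrh : b.height r = 1 - P.pairingIn ℤ k j := by
    rw [b.height_reflectionPerm k j.2, height_one_of_mem_support hks]
  have hr : r ∈ ((b.inversionSet w).erase j).erase k := by
    have hrpos : b.IsPos r := by rw [isPos_iff]; lia
    have hne (i : ι) (hi : i ∈ b.support) : r ≠ i := by
      rintro h
      rw [h, height_one_of_mem_support hi] at hrh
      lia
    simp only [Finset.mem_erase]
    exact ⟨hne k hks, hne j j.2, b.mem_inversionSet.mpr ⟨hrpos,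
      b.not_isPos_smul_of_mem_posRoots (J := Finset.univ) (fun i _ ↦ hall i)
        (b.mem_posRoots.mpr ⟨hrpos, by simp⟩)⟩⟩
  have := Finset.single_le_sum (f := b.height) (fun i hi ↦
    hpos i (Finset.mem_of_mem_erase (Finset.mem_of_mem_erase hi))) hr
  have hk1 := height_one_of_mem_support (b := b) hks
  lia

omit [P.IsCrystallographic] [P.IsReduced] in
lemma two_le_heightSum_univ (h2 : b.support.card = 2) : 2 ≤ b.heightSum Finset.univ := by
  have h : ∑ i ∈ b.support, b.height i ≤ b.heightSum Finset.univ :=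
    Finset.sum_le_sum_of_subset_of_nonneg
      (fun i hi ↦ b.mem_posRoots.mpr ⟨isPos_of_mem_support hi, by simp⟩)
      fun _ hi _ ↦ (b.mem_posRoots.mp hi).1.le
  rw [Finset.sum_congr rfl fun i hi ↦ height_one_of_mem_support hi] at h
  simpa [h2] using h

end RootPairing.Base

/-! ### Evaluating the atomic length along a walk in the Weyl group -/

/-- Evaluation of `k n` which makes the kernel evaluate `n` first. -/
def Nat.strict {α : Type*} (n : ℕ) (k : ℕ → α) : α :=
  match n with
  | 0 => k 0
  | m + 1 => k (m + 1)

lemma Nat.strict_eq {α : Type*} (n : ℕ) (k : ℕ → α) : n.strict k = k n := by cases n <;> rfl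

/-- Evaluation of `k z` which makes the kernel evaluate `z` first. -/
def Int.strict {α : Type*} (z : ℤ) (k : ℤ → α) : α :=
  match z with
  | .ofNat n => n.strict fun n ↦ k (.ofNat n)
  | .negSucc n => n.strict fun n ↦ k (.negSucc n)

lemma Int.strict_eq {α : Type*} (z : ℤ) (k : ℤ → α) : z.strict k = k z := by
  cases z <;> simp only [Int.strict, Nat.strict_eq]

/-- Evaluation of `k l` which makes the kernel evaluate the entries of `l` first. -/
def List.strict {α : Type*} : List ℤ → (List ℤ → α) → α
  | [], k => k []
  | x :: l, k => x.strict fun x ↦ l.strict fun l ↦ k (x :: l)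

lemma List.strict_eq {α : Type*} (l : List ℤ) (k : List ℤ → α) : l.strict k = k l := by
  induction l generalizing k with
  | nil => rfl
  | cons x l ih => rw [List.strict, Int.strict_eq, ih]

/-- A walk in the Weyl group of the Cartan matrix `T`, encoded by the base `n` digits of `code`.
The list `st` records the coordinates of the current image of the Weyl vector, and `s` the current
atomic length; the result is the bit mask of all atomic lengths met so far. -/
def walkMask (T : List (List ℤ)) (n : ℕ) : ℕ → ℕ → ℤ → List ℤ → ℕ → ℕ
  | 0, _, _, _, mask => mask
  | fuel + 1, code, s, st, mask =>
    (st.getD (code % n) 0).strict fun m ↦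
    (s + m).strict fun s ↦
    (mask ||| 1 <<< s.toNat).strict fun mask ↦
    (List.zipWith (fun a r ↦ a - m * r) st (T.getD (code % n) [])).strict fun st ↦
    (code / n).strict fun code ↦
    walkMask T n fuel code s st mask

/-- The numerical check behind `AttainsInterval.of_walk`: `c` is the sum of the positive roots, and
the walk meets every atomic length up to the symmetry `z ↦ L - z`. -/
def walkCheck (T : List (List ℤ)) (c : List ℤ) (n fuel code : ℕ) : Bool :=
  (walkMask T n fuel code 0 (List.replicate n 1) 1).strict fun mask ↦
  0 < n && T.all (fun r ↦ r.length == n) && T.length == n &&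
    (List.range n).all (fun j ↦
      ((List.range n).map fun i ↦ c.getD i 0 * (T.getD i []).getD j 0).sum == 2) &&
    (((List.range n).map fun i ↦ c.getD i 0).sum.toNat.strict fun L ↦
      (List.range (L + 1)).all fun z ↦ mask.testBit z || mask.testBit (L - z))

/-! ### Correctness of the walk certificate. -/

namespace RootPairing.Base

variable {ι M N : Type*} [Fintype ι] [AddCommGroup M] [Module ℝ M] [AddCommGroup N] [Module ℝ N]
  {P : RootPairing ι ℝ M N} (b : P.Base) [P.IsCrystallographic] [P.IsReduced]

lemma mul_heightSum_image [P.IsRootSystem] [DecidableEq b.support] {g : ℕ → b.support} {n : ℕ}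
    (hg : Set.InjOn g (Finset.range n)) {c : ℕ → ℤ} {k : ℤ}
    (h : ∀ j < n, ∑ i ∈ Finset.range n, c i * P.pairingIn ℤ (g i) (g j) = 2 * k) :
    k * b.heightSum ((Finset.range n).image g) = ∑ i ∈ Finset.range n, c i := by
  have hinv := hg.leftInvOn_invFunOn
  rw [b.mul_heightSum_eq (c := fun x ↦ c (Function.invFunOn g (Finset.range n) x)),
    Finset.sum_image hg]
  · exact Finset.sum_congr rfl fun i hi ↦ by rw [hinv (Finset.mem_coe.mpr hi)]
  · intro x hx
    obtain ⟨j, hj, rfl⟩ := Finset.mem_image.mp hx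
    rw [Finset.sum_image hg, ← h j (Finset.mem_range.mp hj)]
    exact Finset.sum_congr rfl fun i hi ↦ by rw [hinv (Finset.mem_coe.mpr hi)]

/-- The invariant of the walk: `s` is ℒ(w), `st` lists ⟨wρ, α_j^∨⟩ for the current w, and every bit
in the mask is an attained value. -/
lemma walkMask_spec [DecidableEq b.support] {g : ℕ → b.support} {n : ℕ} (hn : 0 < n)
    {T : List (List ℤ)} (hT : ∀ i < n, T.getD i [] =
      (List.range n).map fun j ↦ P.pairingIn ℤ (g i) (g j))
    (fuel code : ℕ) (w : P.weylGroup) (hw : w ∈ b.parabolicWeyl ((Finset.range n).image g))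
    (mask : ℕ) (hmask : ∀ z, mask.testBit z →
      ∃ w ∈ b.parabolicWeyl ((Finset.range n).image g), b.atomicLength w = z) (z : ℕ)
    (hz : (walkMask T n fuel code (b.atomicLength w)
      ((List.range n).map fun j ↦ b.flip.height (w⁻¹ • (g j : ι))) mask).testBit z) :
    ∃ w ∈ b.parabolicWeyl ((Finset.range n).image g), b.atomicLength w = z := by
  induction fuel generalizing code w mask with
  | zero => exact hmask z hz
  | succ fuel ih =>
    simp only [walkMask, Nat.strict_eq, Int.strict_eq, List.strict_eq] at hz
    have hi := Nat.mod_lt code hn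
    set i := code % n
    have hm : ((List.range n).map fun j ↦ b.flip.height (w⁻¹ • (g j : ι))).getD i 0 =
        b.flip.height (w⁻¹ • (g i : ι)) := by
      simp [hi]
    rw [hm, hT i hi, List.zipWith_map, List.zipWith_self] at hz
    have hw' := mul_mem (b.ofIdx_mem_parabolicWeyl
      (Finset.mem_image_of_mem g (Finset.mem_range.mpr hi))) hw
    rw [← atomicLength_ofIdx_mul] at hz
    refine ih (code / n) _ hw'
      (mask ||| 1 <<< (b.atomicLength (weylGroup.ofIdx P (g i : ι) * w)).toNat) ?_ ?_
    · intro z' hz'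
      rw [Nat.testBit_or, Bool.or_eq_true] at hz'
      rcases hz' with hz' | hz'
      · exact hmask z' hz'
      · rw [Nat.one_shiftLeft, Nat.testBit_two_pow, decide_eq_true_eq] at hz'
        exact ⟨_, hw', by rw [← hz', Int.toNat_of_nonneg (b.atomicLength_nonneg _)]⟩
    · convert hz using 5 with j
      rw [flip_height_ofIdx_mul, mul_comm]

/-- A certificate for `AttainsInterval`. -/
lemma AttainsInterval.of_walk [P.IsRootSystem] [DecidableEq b.support] {g : ℕ → b.support} {n : ℕ}
    (hg : Set.InjOn g (Finset.range n)) {T : List (List ℤ)} {c : List ℤ} {fuel code : ℕ}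
    (hcheck : walkCheck T c n fuel code = true)
    (hT : ∀ i < n, ∀ j < n, P.pairingIn ℤ (g i) (g j) = (T.getD i []).getD j 0) :
    b.AttainsInterval ((Finset.range n).image g) := by
  simp only [walkCheck, Nat.strict_eq, Bool.and_eq_true, decide_eq_true_eq, List.all_eq_true,
    beq_iff_eq, List.mem_range, Bool.or_eq_true] at hcheck
  obtain ⟨⟨⟨⟨hn, hrow⟩, hlen⟩, hc⟩, hmask⟩ := hcheck
  have hrowT : ∀ i < n, T.getD i [] = (List.range n).map fun j ↦ P.pairingIn ℤ (g i) (g j) := by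
    intro i hi
    have hl : (T.getD i []).length = n := by
      rw [List.getD_eq_getElem _ _ (hlen ▸ hi)]
      exact hrow _ (List.getElem_mem _)
    refine List.ext_getElem (by rw [hl]; simp) fun j hj _ ↦ ?_
    rw [List.getElem_map, List.getElem_range, hT i hi j (hl ▸ hj)]
    exact (List.getD_eq_getElem _ _ hj).symm
  have hsum (f : ℕ → ℤ) : ((List.range n).map f).sum = ∑ i ∈ Finset.range n, f i := by
    clear * -
    induction n with
    | zero => rfl
    | succ n ih => simp [List.range_succ, Finset.sum_range_succ, ih]
  have hL : b.heightSum ((Finset.range n).image g) = ∑ i ∈ Finset.range n, c.getD i 0 := by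
    rw [← one_mul (b.heightSum _)]
    refine b.mul_heightSum_image hg fun j hj ↦ ?_
    rw [mul_one, ← hc j hj, hsum]
    exact Finset.sum_congr rfl fun i hi ↦ by rw [hT i (Finset.mem_range.mp hi) j hj]
  rw [hsum, ← hL] at hmask
  set L := b.heightSum ((Finset.range n).image g)
  have hL0 : 0 ≤ L := Finset.sum_nonneg fun _ hi ↦ (b.mem_posRoots.mp hi).1.le
  have key (z : ℕ) (hz : (walkMask T n fuel code 0 (List.replicate n 1) 1).testBit z) :
      ∃ w ∈ b.parabolicWeyl ((Finset.range n).image g), b.atomicLength w = z := by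
    refine b.walkMask_spec hn hrowT fuel code 1 (one_mem _) 1 ?_ z ?_
    · intro z hz
      rw [show 1 = 2 ^ 0 from rfl, Nat.testBit_two_pow, decide_eq_true_eq] at hz
      exact ⟨1, one_mem _, by rw [atomicLength_one, ← hz]; rfl⟩
    · rw [atomicLength_one]
      convert hz
      refine (List.eq_replicate_iff.mpr ⟨by simp, fun x hx ↦ ?_⟩)
      obtain ⟨j, -, rfl⟩ := List.mem_map.mp hx
      rw [inv_one, one_smul]
      exact height_one_of_mem_support (b := b.flip) (g j).2
  intro z hz hzL
  rcases hmask z.toNat (by lia) with h | h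
  · obtain ⟨w, hw, hw'⟩ := key _ h
    exact ⟨w, hw, by lia⟩
  · obtain ⟨w, hw, hw'⟩ := key _ h
    obtain ⟨v, hv, hv'⟩ := b.exists_atomicLength_eq_sub hw
    refine ⟨v, hv, ?_⟩
    rw [hv', hw', Nat.cast_sub (by lia)]
    lia

end RootPairing.Base

/-! ### Families of Cartan matrices -/

/-- The Cartan matrix of a simply laced path. -/
def pathCartan (i j : ℕ) : ℤ := if i = j then 2 else if i + 1 = j ∨ j + 1 = i then -1 else 0

/-- The Cartan matrix of a simply laced path with vertices `1, 2, …` together with a vertex `0`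
joined to the vertex `k + 1`, with entries `-a` and `-c`. -/
def forkCartan (k : ℕ) (a c : ℤ) : ℕ → ℕ → ℤ
  | 0, 0 => 2
  | 0, j + 1 => if j = k then -a else 0
  | i + 1, 0 => if i = k then -c else 0
  | i + 1, j + 1 => pathCartan i j

/-- The Cartan matrix of type `F₄`. -/
def f4Cartan (i j : ℕ) : ℤ := if i = 2 ∧ j = 1 then -2 else pathCartan i j

/-- A path Cartan matrix acts as minus a second difference; `f m = 0` is the boundary condition that
makes the formula uniform at the far end. -/
lemma sum_mul_pathCartan_zero (f : ℕ → ℤ) {m : ℕ} (hm : 0 < m) (hf : f m = 0) :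
    ∑ i ∈ Finset.range m, f i * pathCartan i 0 = 2 * f 0 - f 1 := by
  obtain ⟨m, rfl⟩ : ∃ k, m = k + 1 := ⟨m - 1, by lia⟩
  have h (i : ℕ) : f i * pathCartan i 0 =
      (if i = 0 then 2 * f 0 else 0) - (if i = 1 then f 1 else 0) := by
    rcases eq_or_ne i 0 with rfl | h0
    · simp [pathCartan]; ring
    · rcases eq_or_ne i 1 with rfl | h1
      · simp [pathCartan]
      · rw [pathCartan, if_neg h0, if_neg (by lia), if_neg h0, if_neg h1]; ring
  rw [Finset.sum_congr rfl fun i _ ↦ h i, Finset.sum_sub_distrib, Finset.sum_ite_eq',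
    Finset.sum_ite_eq', if_pos (by simp)]
  split_ifs with h1
  · rfl
  · rw [show 1 = m + 1 by simp at h1; lia, hf]

lemma sum_mul_pathCartan_succ (f : ℕ → ℤ) {m j : ℕ} (hm : j + 1 < m) (hf : f m = 0) :
    ∑ i ∈ Finset.range m, f i * pathCartan i (j + 1) = 2 * f (j + 1) - f j - f (j + 2) := by
  have h (i : ℕ) : f i * pathCartan i (j + 1) = (if i = j + 1 then 2 * f (j + 1) else 0) -
      (if i = j then f j else 0) - (if i = j + 2 then f (j + 2) else 0) := by
    rcases eq_or_ne i j with rfl | h0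
    · simp [pathCartan]
    · rcases eq_or_ne i (j + 1) with rfl | h1
      · simp [pathCartan]; ring
      · rcases eq_or_ne i (j + 2) with rfl | h2
        · simp [pathCartan]
        · rw [pathCartan, if_neg h1, if_neg (by lia), if_neg h0, if_neg h1, if_neg h2]; ring
  rw [Finset.sum_congr rfl fun i _ ↦ h i, Finset.sum_sub_distrib, Finset.sum_sub_distrib,
    Finset.sum_ite_eq', Finset.sum_ite_eq', Finset.sum_ite_eq', if_pos (by simpa),
    if_pos (by simp; lia)]
  split_ifs with h1
  · rfl
  · rw [show j + 2 = m by simp at h1; lia, hf]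

lemma sum_mul_forkCartan_zero (f : ℕ → ℤ) (k : ℕ) (a c : ℤ) {m : ℕ} (hk : k < m) :
    ∑ i ∈ Finset.range (m + 1), f i * forkCartan k a c i 0 = 2 * f 0 - c * f (k + 1) := by
  rw [Finset.sum_range_succ', Finset.sum_eq_single_of_mem k (by simpa)]
  · simp [forkCartan]; ring
  · intro i _ hi
    simp [forkCartan, hi]

lemma sum_mul_forkCartan_succ (f : ℕ → ℤ) (k : ℕ) (a c : ℤ) {m j : ℕ} :
    ∑ i ∈ Finset.range (m + 1), f i * forkCartan k a c i (j + 1) =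
      ∑ i ∈ Finset.range m, f (i + 1) * pathCartan i j - if j = k then a * f 0 else 0 := by
  rw [Finset.sum_range_succ']
  simp only [forkCartan]
  split_ifs <;> ring

namespace RootPairing.Base

variable {ι M N : Type*} [Fintype ι] [AddCommGroup M] [Module ℝ M] [AddCommGroup N] [Module ℝ N]
  {P : RootPairing ι ℝ M N} (b : P.Base) [P.IsCrystallographic] [P.IsReduced]

omit [Fintype ι] [P.IsReduced] in
/-- The first `n` values of `g` are distinct and span a diagram with Cartan matrix `X`. -/
def HasShape (g : ℕ → b.support) (n : ℕ) (X : ℕ → ℕ → ℤ) : Prop :=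
  Set.InjOn g (Finset.range n) ∧ ∀ i < n, ∀ j < n, P.pairingIn ℤ (g i) (g j) = X i j

variable {b} {g : ℕ → b.support}

omit [Fintype ι] [P.IsReduced] in
lemma HasShape.mono {m n : ℕ} {X : ℕ → ℕ → ℤ} (h : b.HasShape g n X) (hmn : m ≤ n) :
    b.HasShape g m X :=
  ⟨h.1.mono (by simpa using hmn), fun i hi j hj ↦ h.2 i (by lia) j (by lia)⟩

variable [P.IsRootSystem] [DecidableEq b.support]

lemma HasShape.attainsInterval_of_walk {n : ℕ} {X : ℕ → ℕ → ℤ} (h : b.HasShape g n X)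
    {T : List (List ℤ)} {c : List ℤ} {fuel code : ℕ} (hcheck : walkCheck T c n fuel code = true)
    (hT : ∀ i < n, ∀ j < n, X i j = (T.getD i []).getD j 0) :
    b.AttainsInterval ((Finset.range n).image g) :=
  .of_walk b h.1 hcheck fun i hi j hj ↦ by rw [h.2 i hi j hj, hT i hi j hj]

lemma HasShape.mul_heightSum {n : ℕ} {X : ℕ → ℕ → ℤ} (h : b.HasShape g n X) {c : ℕ → ℤ} {k : ℤ}
    (hc : ∀ j < n, ∑ i ∈ Finset.range n, c i * X i j = 2 * k) :
    k * b.heightSum ((Finset.range n).image g) = ∑ i ∈ Finset.range n, c i :=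
  b.mul_heightSum_image h.1 fun j hj ↦ by
    rw [← hc j hj]
    exact Finset.sum_congr rfl fun i hi ↦ by rw [h.2 i (Finset.mem_range.mp hi) j hj]

/-! #### Type `A` -/

lemma HasShape.heightSum_A {m : ℕ} (hm : 0 < m) (h : b.HasShape g (m + 1) (forkCartan 0 1 1)) :
    6 * b.heightSum ((Finset.range (m + 1)).image g) = (m + 1) * (m + 2) * (m + 3) := by
  -- The coefficients of 2ρ in type A, numbered from 0.
  have key := h.mul_heightSum (c := fun i ↦ (i + 1) * (m + 1 - i)) (k := 1) (by
    rintro (_ | j) hj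
    · rw [sum_mul_forkCartan_zero _ _ _ _ hm]; push_cast; ring
    · rw [sum_mul_forkCartan_succ]
      rcases j with _ | j
      · rw [sum_mul_pathCartan_zero _ hm (by push_cast; ring)]; push_cast; simp; ring
      · rw [sum_mul_pathCartan_succ _ (by lia) (by push_cast; ring)]; push_cast; simp; ring)
  have hsum (n : ℤ) (k : ℕ) : 6 * ∑ i ∈ Finset.range k, ((i : ℤ) + 1) * (n - i) =
      k * (k + 1) * (3 * n - 2 * k + 2) := by
    induction k with
    | zero => simp
    | succ k ih => rw [Finset.sum_range_succ, mul_add, ih]; push_cast; ring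
  rw [one_mul] at key
  rw [key, hsum]
  push_cast
  ring

lemma HasShape.attainsInterval_A {n : ℕ} (hn : 3 ≤ n) (h : b.HasShape g n (forkCartan 0 1 1)) :
    b.AttainsInterval ((Finset.range n).image g) := by
  induction n, hn using Nat.le_induction with
  | base =>
    refine h.attainsInterval_of_walk (T := [[2, -1, 0], [-1, 2, -1], [0, -1, 2]])
      (c := [3, 4, 3])
      (fuel := 5) (code := 150)
      (by decide +kernel) (by decide)
  | succ n hn ih =>
    -- The first instance is 20 ≤ 2 · 10 + 1. Rank 2 could not serve as a base: there L = 4, while L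
    -- = 10 in rank 3.
    refine (ih (h.mono n.le_succ)).mono b
      (Finset.image_subset_image (Finset.range_mono n.le_succ)) ?_
    have h1 := h.heightSum_A (by lia)
    obtain ⟨t, rfl⟩ := Nat.exists_eq_add_of_le' hn
    have h2 := (h.mono (Nat.le_succ _)).heightSum_A (m := t + 2) (by lia)
    push_cast at h1 h2
    have : (0 : ℤ) ≤ t := t.cast_nonneg
    nlinarith [mul_nonneg this this, mul_nonneg this (mul_nonneg this this)]

/-! #### Types `B` and `C` -/

lemma HasShape.heightSum_B {m : ℕ} (hm : 0 < m) (h : b.HasShape g (m + 1) (forkCartan 0 1 2)) :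
    6 * b.heightSum ((Finset.range (m + 1)).image g) = (m + 1) * (m + 2) * (4 * m + 3) := by
  have key := h.mul_heightSum (c := fun i ↦ (m + 1) ^ 2 - i ^ 2) (k := 1) (by
    rintro (_ | j) hj
    · rw [sum_mul_forkCartan_zero _ _ _ _ hm]; push_cast; ring
    · rw [sum_mul_forkCartan_succ]
      rcases j with _ | j
      · rw [sum_mul_pathCartan_zero _ hm (by push_cast; ring)]; push_cast; simp; ring
      · rw [sum_mul_pathCartan_succ _ (by lia) (by push_cast; ring)]; push_cast; simp; ring)
  have hsum (n : ℤ) (k : ℕ) : 6 * ∑ i ∈ Finset.range k, (n ^ 2 - (i : ℤ) ^ 2) =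
      6 * k * n ^ 2 - (k - 1) * k * (2 * k - 1) := by
    induction k with
    | zero => simp
    | succ k ih => rw [Finset.sum_range_succ, mul_add, ih]; push_cast; ring
  rw [one_mul] at key
  rw [key, hsum]
  push_cast
  ring

lemma HasShape.heightSum_C {m : ℕ} (hm : 0 < m) (h : b.HasShape g (m + 1) (forkCartan 0 2 1)) :
    6 * b.heightSum ((Finset.range (m + 1)).image g) = (m + 1) * (m + 2) * (4 * m + 3) := by
  -- Twice the coefficients of 2ρ, whence k = 2: the coefficient at the long end is (m + 1)(m +
  -- 2)/2, and doubling avoids the division.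
  have key := h.mul_heightSum (c := fun i ↦ if i = 0 then ((m : ℤ) + 1) * (m + 2)
      else 2 * (m + 1 - i) * (m + 2 + i)) (k := 2) (by
    rintro (_ | j) hj
    · rw [sum_mul_forkCartan_zero _ _ _ _ hm]; push_cast; simp; ring
    · rw [sum_mul_forkCartan_succ]
      rcases j with _ | j
      · rw [sum_mul_pathCartan_zero _ hm (by push_cast; simp)]; push_cast; simp; ring
      · rw [sum_mul_pathCartan_succ _ (by lia) (by push_cast; simp)]; push_cast; simp; ring)
  have hsum (n : ℤ) (k : ℕ) : 3 * ∑ i ∈ Finset.range k,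
      2 * (n + 1 - ((i + 1 : ℕ) : ℤ)) * (n + 2 + (i + 1 : ℕ)) =
      2 * k * (3 * n ^ 2 + 9 * n - k ^ 2 - 3 * k + 4) := by
    induction k with
    | zero => simp
    | succ k ih => rw [Finset.sum_range_succ, mul_add, ih]; push_cast; ring
  rw [Finset.sum_range_succ'] at key
  simp only [if_true, Nat.succ_ne_zero, if_false] at key
  linear_combination 3 * key + hsum m m

lemma heightSum_step_BC {n : ℕ} (hn : 4 ≤ n) {x y : ℤ}
    (hx : 6 * x = (n + 1) * (n + 2) * (4 * n + 3)) (hy : 6 * y = n * (n + 1) * (4 * n - 1)) :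
    x ≤ 2 * y + 1 := by
  obtain ⟨t, rfl⟩ := Nat.exists_eq_add_of_le' hn
  push_cast at hx hy
  have : (0 : ℤ) ≤ t := t.cast_nonneg
  nlinarith [mul_nonneg this this, mul_nonneg this (mul_nonneg this this)]

lemma HasShape.attainsInterval_B {n : ℕ} (hn : 3 ≤ n) (h : b.HasShape g n (forkCartan 0 1 2)) :
    b.AttainsInterval ((Finset.range n).image g) := by
  -- Ranks 3 and 4 both need a walk: L is 22 and 50, and 50 > 2 · 22 + 1. The induction works from
  -- rank 4 on. Type C has the same sums.
  rcases hn.eq_or_lt with rfl | hlt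
  · refine h.attainsInterval_of_walk (T := [[2, -1, 0], [-2, 2, -1], [0, -1, 2]])
      (c := [9, 8, 5])
      (fuel := 11) (code := 100910)
      (by decide +kernel) (by decide)
  clear hn
  induction n, Nat.succ_le_of_lt hlt using Nat.le_induction with
  | base =>
    refine h.attainsInterval_of_walk (T := [[2, -1, 0, 0], [-2, 2, -1, 0], [0, -1, 2, -1], [0, 0, -1, 2]])
      (c := [16, 15, 12, 7])
      (fuel := 29) (code := 178231129953919783)
      (by decide +kernel) (by decide)
  | succ n hn ih =>
    refine (ih (h.mono n.le_succ) hn).mono b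
      (Finset.image_subset_image (Finset.range_mono n.le_succ)) ?_
    have h1 := h.heightSum_B (by lia)
    obtain ⟨t, rfl⟩ := Nat.exists_eq_add_of_le' hn
    have h2 := (h.mono (Nat.le_succ _)).heightSum_B (m := t + 3) (by lia)
    refine heightSum_step_BC hn h1 (h2.trans ?_)
    push_cast
    ring

lemma HasShape.attainsInterval_C {n : ℕ} (hn : 3 ≤ n) (h : b.HasShape g n (forkCartan 0 2 1)) :
    b.AttainsInterval ((Finset.range n).image g) := by
  rcases hn.eq_or_lt with rfl | hlt
  · refine h.attainsInterval_of_walk (T := [[2, -2, 0], [-1, 2, -1], [0, -1, 2]])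
      (c := [6, 10, 6])
      (fuel := 13) (code := 952224)
      (by decide +kernel) (by decide)
  clear hn
  induction n, Nat.succ_le_of_lt hlt using Nat.le_induction with
  | base =>
    refine h.attainsInterval_of_walk (T := [[2, -2, 0, 0], [-1, 2, -1, 0], [0, -1, 2, -1], [0, 0, -1, 2]])
      (c := [10, 18, 14, 8])
      (fuel := 28) (code := 5130122731172152)
      (by decide +kernel) (by decide)
  | succ n hn ih =>
    refine (ih (h.mono n.le_succ) hn).mono b
      (Finset.image_subset_image (Finset.range_mono n.le_succ)) ?_
    have h1 := h.heightSum_C (by lia)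
    obtain ⟨t, rfl⟩ := Nat.exists_eq_add_of_le' hn
    have h2 := (h.mono (Nat.le_succ _)).heightSum_C (m := t + 3) (by lia)
    refine heightSum_step_BC hn h1 (h2.trans ?_)
    push_cast
    ring

/-! #### Type `D` -/

lemma HasShape.heightSum_D {m : ℕ} (hm : 1 < m) (h : b.HasShape g (m + 1) (forkCartan 1 1 1)) :
    3 * b.heightSum ((Finset.range (m + 1)).image g) = (m + 1) * m * (2 * m + 1) := by
  obtain ⟨m, rfl⟩ : ∃ k, m = k + 1 := ⟨m - 1, by lia⟩
  -- Again doubled coefficients of 2ρ; the vertices 0 and 1 are the two short arms of the fork.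
  have key := h.mul_heightSum (c := fun i ↦ if i ≤ 1 then ((m : ℤ) + 2) * (m + 1)
      else 2 * (m + 2 - i) * (m + 1 + i)) (k := 2) (by
    rintro (_ | j) hj
    · rw [sum_mul_forkCartan_zero _ _ _ _ hm]; push_cast; simp; ring
    · rw [sum_mul_forkCartan_succ]
      have h0 : ¬ m + 1 + 1 ≤ 1 := by lia
      rcases j with _ | _ | j
      · rw [sum_mul_pathCartan_zero _ (by lia) (by rw [if_neg h0]; push_cast; ring)]
        push_cast; simp; ring
      · rw [sum_mul_pathCartan_succ _ (by lia) (by rw [if_neg h0]; push_cast; ring)]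
        push_cast; simp; ring
      · rw [sum_mul_pathCartan_succ _ (by lia) (by rw [if_neg h0]; push_cast; ring)]
        push_cast; simp; ring)
  have hsum (n : ℤ) (k : ℕ) : 3 * ∑ i ∈ Finset.range k,
      2 * (n + 2 - ((i + 1 + 1 : ℕ) : ℤ)) * (n + 1 + (i + 1 + 1 : ℕ)) =
      2 * k * (3 * n ^ 2 + 9 * n - k ^ 2 - 3 * k + 4) := by
    induction k with
    | zero => simp
    | succ k ih => rw [Finset.sum_range_succ, mul_add, ih]; push_cast; ring
  rw [Finset.sum_range_succ', Finset.sum_range_succ'] at key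
  simp only [zero_add, le_refl, Nat.zero_le, if_true,
    show ∀ i, ¬ i + 1 + 1 ≤ 1 by lia, if_false] at key
  refine mul_left_cancel₀ (two_ne_zero (α := ℤ)) ?_
  push_cast
  linear_combination 3 * key + hsum m m

lemma HasShape.attainsInterval_D {n : ℕ} (hn : 4 ≤ n) (h : b.HasShape g n (forkCartan 1 1 1)) :
    b.AttainsInterval ((Finset.range n).image g) := by
  -- L is 28 in rank 4 and 60 > 2 · 28 + 1 in rank 5, so both are starting cases.
  rcases hn.eq_or_lt with rfl | hlt
  · refine h.attainsInterval_of_walk (T := [[2, 0, -1, 0], [0, 2, -1, 0], [-1, -1, 2, -1], [0, 0, -1, 2]])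
      (c := [6, 6, 10, 6])
      (fuel := 17) (code := 14537033607)
      (by decide +kernel) (by decide)
  clear hn
  induction n, Nat.succ_le_of_lt hlt using Nat.le_induction with
  | base =>
    refine h.attainsInterval_of_walk (T := [[2, 0, -1, 0, 0], [0, 2, -1, 0, 0], [-1, -1, 2, -1, 0],
        [0, 0, -1, 2, -1], [0, 0, 0, -1, 2]])
      (c := [10, 10, 18, 14, 8])
      (fuel := 35) (code := 1106696539105667997288476)
      (by decide +kernel) (by decide)
  | succ n hn ih =>
    refine (ih (h.mono n.le_succ) hn).mono b
      (Finset.image_subset_image (Finset.range_mono n.le_succ)) ?_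
    have h1 := h.heightSum_D (by lia)
    obtain ⟨t, rfl⟩ := Nat.exists_eq_add_of_le' hn
    have h2 := (h.mono (Nat.le_succ _)).heightSum_D (m := t + 4) (by lia)
    push_cast at h1 h2
    have : (0 : ℤ) ≤ t := t.cast_nonneg
    nlinarith [mul_nonneg this this, mul_nonneg this (mul_nonneg this this)]

/-! #### Exceptional types and rank one -/

lemma HasShape.attainsInterval_one {X : ℕ → ℕ → ℤ} (h : b.HasShape g 1 X) :
    b.AttainsInterval ((Finset.range 1).image g) := by
  refine .of_walk b h.1 (T := [[2]])
      (c := [1])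
      (fuel := 0) (code := 0)
      (by decide +kernel) fun i hi j hj ↦ ?_
  obtain rfl : i = 0 := by lia
  obtain rfl : j = 0 := by lia
  simp

/-- The exceptional sums 110, 156, 399 and 1240 (F₄, E₆, E₇, E₈) exceed 2 L_J + 1 for every proper
J, so each type needs its own walk. -/
lemma HasShape.attainsInterval_F4 (h : b.HasShape g 4 f4Cartan) :
    b.AttainsInterval ((Finset.range 4).image g) := by
  refine h.attainsInterval_of_walk (T := [[2, -1, 0, 0], [-1, 2, -1, 0], [0, -2, 2, -1], [0, 0, -1, 2]])
      (c := [22, 42, 30, 16])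
      (fuel := 73) (code := 62322128043576560604726927888705871161083057)
      (by decide +kernel) (by decide)

lemma HasShape.attainsInterval_E6 (h : b.HasShape g 6 (forkCartan 2 1 1)) :
    b.AttainsInterval ((Finset.range 6).image g) := by
  refine h.attainsInterval_of_walk (T := [[2, 0, 0, -1, 0, 0], [0, 2, -1, 0, 0, 0], [0, -1, 2, -1, 0, 0],
        [-1, 0, -1, 2, -1, 0], [0, 0, 0, -1, 2, -1], [0, 0, 0, 0, -1, 2]])
      (c := [22, 16, 30, 42, 30, 16])
      (fuel := 92) (code := 243959846769450942839069549636913483935026184198498395816877748764110265)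
      (by decide +kernel) (by decide)

lemma HasShape.attainsInterval_E7 (h : b.HasShape g 7 (forkCartan 2 1 1)) :
    b.AttainsInterval ((Finset.range 7).image g) := by
  refine h.attainsInterval_of_walk (T := [[2, 0, 0, -1, 0, 0, 0], [0, 2, -1, 0, 0, 0, 0], [0, -1, 2, -1, 0, 0, 0],
        [-1, 0, -1, 2, -1, 0, 0], [0, 0, 0, -1, 2, -1, 0], [0, 0, 0, 0, -1, 2, -1],
        [0, 0, 0, 0, 0, -1, 2]])
      (c := [49, 34, 66, 96, 75, 52, 27])
      (fuel := 236) (code := 23380554867612836181485769567012492598501442894610331470644282865865697459581857315428805662682304505508632618201831084471355746503800185645533164211212481574578233504361913026397079582739927500192946)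
      (by decide +kernel) (by decide)

lemma HasShape.attainsInterval_E8 (h : b.HasShape g 8 (forkCartan 2 1 1)) :
    b.AttainsInterval ((Finset.range 8).image g) := by
  refine h.attainsInterval_of_walk (T := [[2, 0, 0, -1, 0, 0, 0, 0], [0, 2, -1, 0, 0, 0, 0, 0], [0, -1, 2, -1, 0, 0, 0, 0],
        [-1, 0, -1, 2, -1, 0, 0, 0], [0, 0, 0, -1, 2, -1, 0, 0], [0, 0, 0, 0, -1, 2, -1, 0],
        [0, 0, 0, 0, 0, -1, 2, -1], [0, 0, 0, 0, 0, 0, -1, 2]])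
      (c := [136, 92, 182, 270, 220, 168, 114, 58])
      (fuel := 758) (code := 2031774214607807711484059941496923057005070122918958836276592938471163537835251066081892255617901112702438619642566554724264505858574610831274074357833551832486406429509414267872531868947966266409679571704836480663863605354135933534504796733942888309379448414356923167260251544307136878649164833868040379501626090090425772404566966050878350691134574974786486504874762638053081036700310245345485253895311606529311766223539473024453780259336994150447253216237347982889201145719075752067768563637764906860390643246493708463697288460366138041526085999876091329118750277153776891437041802209034557321714566300357878962156034322423786789361956030834493837405499579924037178159449443271127294)
      (by decide +kernel) (by decide)

end RootPairing.Base

/-! ### Classification of connected Cartan matrices of finite type -/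

/-- A Cartan matrix of finite type, in the form of Vinberg's criterion. -/
structure IsFiniteCartan {I : Type*} [Fintype I] (A : I → I → ℤ) : Prop where
  diag (i) : A i i = 2
  nonpos {i j} : i ≠ j → A i j ≤ 0
  zero_symm {i j} : A i j = 0 → A j i = 0
  exists_pos (u : I → ℤ) : (∀ i, 0 ≤ u i) → u ≠ 0 → ∃ i, 0 < u i ∧ 0 < ∑ j, A i j * u j

/-- The sequence `v, f 0, f 1, …`. -/
def consSeq {I : Type*} (v : I) (f : ℕ → I) : ℕ → I
  | 0 => v
  | i + 1 => f i

lemma injOn_consSeq {I : Type*} {v : I} {f : ℕ → I} {m : ℕ} (hf : Set.InjOn f (Finset.range m))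
    (hv : ∀ i < m, f i ≠ v) : Set.InjOn (consSeq v f) (Finset.range (m + 1)) := by
  rintro (_ | i) hi (_ | j) hj h
  · rfl
  · exact absurd h.symm (hv j (by simpa using hj))
  · exact absurd h (hv i (by simpa using hi))
  · rw [hf (by simpa using hi) (by simpa using hj) h]

/-- The Cartan matrix obtained from `X` by joining a new vertex `0` to the first vertex of `X`. -/
def tailCartan (X : ℕ → ℕ → ℤ) : ℕ → ℕ → ℤ
  | 0, 0 => 2
  | 0, 1 => -1
  | 1, 0 => -1
  | 0, _ + 2 => 0
  | _ + 2, 0 => 0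
  | i + 1, j + 1 => X i j

/-! ### Forbidden configurations in diagrams of finite type. -/

namespace IsFiniteCartan

variable {I : Type*} [Fintype I] {A : I → I → ℤ} (hA : IsFiniteCartan A)

include hA

lemma ne_of_neg {i j : I} (h : A i j < 0) : i ≠ j := by
  rintro rfl
  rw [hA.diag] at h
  lia

lemma neg_symm {i j : I} (h : A i j < 0) : A j i < 0 :=
  lt_of_le_of_ne (hA.nonpos (hA.ne_of_neg h).symm) fun h0 ↦ h.ne (hA.zero_symm h0)

lemma sum_le {u : I → ℤ} (hu : ∀ i, 0 ≤ u i) (i : I) : ∑ j, A i j * u j ≤ 2 * u i := by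
  classical
  rw [← Finset.add_sum_erase _ _ (Finset.mem_univ i), hA.diag]
  have : ∑ j ∈ Finset.univ.erase i, A i j * u j ≤ 0 := Finset.sum_nonpos fun j hj ↦
    mul_nonpos_of_nonpos_of_nonneg (hA.nonpos (Finset.ne_of_mem_erase hj).symm) (hu j)
  lia

lemma sum_le_of_subset [DecidableEq I] {S T : Finset I} {i : I} (hST : S ⊆ T)
    (hi : i ∈ T → i ∈ S) : ∑ j ∈ T, A i j ≤ ∑ j ∈ S, A i j := by
  rw [← Finset.sum_sdiff hST]
  have : ∑ j ∈ T \ S, A i j ≤ 0 := Finset.sum_nonpos fun j hj ↦ hA.nonpos (by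
    rintro rfl
    rw [Finset.mem_sdiff] at hj
    exact hj.2 (hi hj.1))
  lia

/-- A configuration with a null vector is not contained in a diagram of finite type. -/
lemma not_null {g : ℕ → I} {n : ℕ} (hg : Set.InjOn g (Finset.range n)) {X : ℕ → ℕ → ℤ}
    (hX : ∀ i < n, ∀ j < n, A (g i) (g j) ≤ X i j) (w : List ℕ) (hn : 0 < n)
    (hw : (∀ i < n, 0 < w.getD i 0) ∧
      ∀ i < n, ∑ j ∈ Finset.range n, X i j * w.getD j 0 ≤ 0) : False := by
  classical
  let u : I → ℤ := fun x ↦ ∑ i ∈ Finset.range n, if g i = x then (w.getD i 0 : ℤ) else 0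
  have hu (i : ℕ) (hi : i < n) : u (g i) = w.getD i 0 := by
    simp only [u]
    rw [Finset.sum_eq_single_of_mem i (Finset.mem_range.mpr hi), if_pos rfl]
    intro j hj hji
    rw [if_neg fun h ↦ hji (hg (Finset.mem_coe.mpr hj) (by simpa using hi) h)]
  obtain ⟨x, hx, hx'⟩ := hA.exists_pos u
    (fun x ↦ Finset.sum_nonneg fun i _ ↦ by split_ifs <;> positivity) (fun h ↦ by
      have h0 := hu 0 hn
      have := hw.1 0 hn
      rw [h, Pi.zero_apply] at h0
      lia)
  obtain ⟨i, hi, hix⟩ := Finset.exists_ne_zero_of_sum_ne_zero hx.ne'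
  rw [Finset.mem_range] at hi
  obtain rfl : g i = x := by
    by_contra h
    exact hix (if_neg h)
  refine absurd hx' (not_lt.mpr (le_trans (le_of_eq ?_) ((Finset.sum_le_sum fun j hj ↦
    mul_le_mul_of_nonneg_right (hX i hi j (Finset.mem_range.mp hj)) ?_).trans (hw.2 i hi))))
  · simp only [u, Finset.mul_sum]
    rw [Finset.sum_comm]
    refine Finset.sum_congr rfl fun j _ ↦ ?_
    simp
  · positivity

/-- There are no cycles in a diagram of finite type. -/
lemma not_cycle {S : Finset I} (hS : S.Nonempty)
    (h : ∀ x ∈ S, ∃ y ∈ S, ∃ z ∈ S, y ≠ z ∧ A x y < 0 ∧ A x z < 0) : False := by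
  classical
  obtain ⟨x, hx, hx'⟩ := hA.exists_pos (fun x ↦ if x ∈ S then 1 else 0)
    (fun x ↦ by split_ifs <;> simp) (fun h0 ↦ by
      obtain ⟨x, hx⟩ := hS
      simpa [hx] using congrFun h0 x)
  have hxS : x ∈ S := by
    by_contra h
    simp [h] at hx
  obtain ⟨y, hy, z, hz, hyz, hxy, hxz⟩ := h x hxS
  have := hA.sum_le_of_subset (S := {x, y, z}) (T := S) (i := x)
    (by simp [Finset.insert_subset_iff, hxS, hy, hz]) (by simp)
  rw [Finset.sum_insert (by simp [hA.ne_of_neg hxy, hA.ne_of_neg hxz]), Finset.sum_pair hyz,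
    hA.diag] at this
  simp at hx'
  lia

omit hA in
/-- The vertices in `S` branch off from `p` as at an end of an affine diagram. -/
def HasEnd (A : I → I → ℤ) (p : I) (S : Finset I) : Prop :=
  ∃ g : I → ℤ, (∀ x, 0 ≤ g x) ∧ (∀ x ∉ S, g x = 0) ∧ ∑ x, A p x * g x ≤ -2 ∧
    ∀ x ∈ S, g x ≤ -A x p

lemma hasEnd_pair [DecidableEq I] {p x y : I} (hxy : x ≠ y) (hx : A p x < 0) (hy : A p y < 0) :
    HasEnd A p {x, y} := by
  refine ⟨fun z ↦ if z ∈ ({x, y} : Finset I) then 1 else 0,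
    fun z ↦ by dsimp only; split_ifs <;> simp, fun z hz ↦ if_neg hz, ?_, fun z hz ↦ ?_⟩
  · simp only [mul_ite, mul_one, mul_zero, Finset.sum_ite_mem, Finset.univ_inter]
    rw [Finset.sum_pair hxy]
    lia
  · dsimp only
    rw [if_pos hz]
    have hx' := hA.neg_symm hx
    have hy' := hA.neg_symm hy
    rcases Finset.mem_insert.mp hz with rfl | hz
    · lia
    · rw [Finset.mem_singleton.mp hz]
      lia

/-- A multiple edge is an affine end by itself: weight 2 if A p x = -1 (then A x p ≤ -2), and weight
1 if A p x ≤ -2. -/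
lemma hasEnd_singleton [DecidableEq I] {p x : I} (hx : A p x < 0)
    (h : ¬ (A p x = -1 ∧ A x p = -1)) : HasEnd A p {x} := by
  have hx' := hA.neg_symm hx
  have key (w : ℤ) (hw : 0 ≤ w) (h1 : A p x * w ≤ -2) (h2 : w ≤ -A x p) : HasEnd A p {x} := by
    refine ⟨fun z ↦ if z = x then w else 0, fun z ↦ by dsimp only; split_ifs <;> simp [hw],
      fun z hz ↦ if_neg (by simpa using hz), ?_, fun z hz ↦ ?_⟩
    · simpa using h1
    · simpa [Finset.mem_singleton.mp hz] using h2
  by_cases h1 : A p x = -1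
  · exact key 2 (by lia) (by lia) (by lia)
  · exact key 1 (by lia) (by lia) (by lia)

/-- A chain with an affine end on both sides does not occur in a diagram of finite type. -/
lemma not_hasEnd_hasEnd [DecidableEq I] {f : ℕ → I} {a b : ℕ} (hab : a ≤ b)
    (hinj : Set.InjOn f (Finset.Icc a b)) (hadj : ∀ i, a ≤ i → i < b → A (f i) (f (i + 1)) < 0)
    {S T : Finset I} (hS : HasEnd A (f a) S) (hT : HasEnd A (f b) T) (hST : Disjoint S T)
    (hfS : ∀ i, a ≤ i → i ≤ b → f i ∉ S) (hfT : ∀ i, a ≤ i → i ≤ b → f i ∉ T) : False := by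
  obtain ⟨g, hg0, hgS, hg, hg'⟩ := hS
  obtain ⟨h, hh0, hhT, hh, hh'⟩ := hT
  set U := (Finset.Icc a b).image f with hU
  have hmem (i : ℕ) (h1 : a ≤ i) (h2 : i ≤ b) : f i ∈ U :=
    Finset.mem_image_of_mem f (Finset.mem_Icc.mpr ⟨h1, h2⟩)
  have hinj' (i j : ℕ) (h1 : a ≤ i) (h2 : i ≤ b) (h3 : a ≤ j) (h4 : j ≤ b) (hij : i ≠ j) :
      f i ≠ f j := fun hf ↦ hij (hinj (by simp [h1, h2]) (by simp [h3, h4]) hf)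
  -- The vector imitates an affine null vector: 2 along the chain and the given weights on the two
  -- ends. Its image under A is ≤ 0 on its support.
  obtain ⟨x, hx, hx'⟩ := hA.exists_pos (fun x ↦ 2 * (if x ∈ U then 1 else 0) + g x + h x)
    (fun x ↦ by have := hg0 x; have := hh0 x; split_ifs <;> lia) (fun h0 ↦ by
      have h1 := congrFun h0 (f a)
      have := hg0 (f a)
      have := hh0 (f a)
      simp [hmem a le_rfl hab] at h1
      lia)
  have hsum : ∑ j, A x j * (2 * (if j ∈ U then 1 else 0) + g j + h j) =
      2 * ∑ j ∈ U, A x j + ∑ j, A x j * g j + ∑ j, A x j * h j := by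
    simp only [mul_add, Finset.sum_add_distrib]
    simp [Finset.sum_mul, mul_comm]
  rw [hsum] at hx'
  have hgx := hA.sum_le hg0 x
  have hhx := hA.sum_le hh0 x
  by_cases hxU : x ∈ U
  · obtain ⟨i, hi, rfl⟩ := Finset.mem_image.mp hxU
    obtain ⟨h1, h2⟩ := Finset.mem_Icc.mp hi
    rw [hgS _ (hfS i h1 h2)] at hgx
    rw [hhT _ (hfT i h1 h2)] at hhx
    rcases h1.eq_or_lt with rfl | h1'
    · rcases h2.eq_or_lt with rfl | h2'
      · have := hA.sum_le_of_subset (S := {f a}) (T := U) (i := f a) (by simpa) (by simp)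
        rw [Finset.sum_singleton, hA.diag] at this
        lia
      · have := hA.sum_le_of_subset (S := {f a, f (a + 1)}) (T := U) (i := f a)
          (by simp [Finset.insert_subset_iff, hxU, hmem (a + 1) (by lia) h2']) (by simp)
        rw [Finset.sum_pair (hA.ne_of_neg (hadj a le_rfl h2')), hA.diag] at this
        have := hadj a le_rfl h2'
        lia
    · obtain ⟨i, rfl⟩ : ∃ k, i = k + 1 := ⟨i - 1, by lia⟩
      have hl := hA.neg_symm (hadj i (by lia) (by lia))
      rcases h2.eq_or_lt with rfl | h2'
      · have := hA.sum_le_of_subset (S := {f (i + 1), f i}) (T := U) (i := f (i + 1))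
          (by simp [Finset.insert_subset_iff, hxU, hmem i (by lia) (by lia)]) (by simp)
        rw [Finset.sum_pair (hA.ne_of_neg hl), hA.diag] at this
        lia
      · have hr := hadj (i + 1) (by lia) h2'
        have := hA.sum_le_of_subset (S := {f (i + 1), f i, f (i + 2)}) (T := U) (i := f (i + 1))
          (by simp [Finset.insert_subset_iff, hxU, hmem i (by lia) (by lia),
            hmem (i + 2) (by lia) (by lia)]) (by simp)
        rw [Finset.sum_insert (by simp [hA.ne_of_neg hl, hA.ne_of_neg hr]),
          Finset.sum_pair (hinj' i (i + 2) (by lia) (by lia) (by lia) (by lia) (by lia)),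
          hA.diag] at this
        lia
  · have key (k : ℕ) (h1 : a ≤ k) (h2 : k ≤ b) : ∑ j ∈ U, A x j ≤ A x (f k) := by
      have := hA.sum_le_of_subset (S := {f k}) (T := U) (i := x) (by simpa using hmem k h1 h2)
        fun h ↦ absurd h hxU
      simpa using this
    simp only [hxU, if_false, mul_zero, zero_add] at hx
    by_cases hxS : x ∈ S
    · have h1 := hhT x (Finset.disjoint_left.mp hST hxS)
      have h2 := hg' x hxS
      have h3 := key a le_rfl hab
      lia
    · have h1 := hgS x hxS
      have hxT : x ∈ T := by
        by_contra h
        have := hhT x h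
        lia
      have h2 := hh' x hxT
      have h3 := key b hab le_rfl
      lia

lemma edge_cases {x y : I} (h : A x y < 0) :
    (A x y = -1 ∧ A y x = -1) ∨ (A x y = -1 ∧ A y x = -2) ∨ (A x y = -2 ∧ A y x = -1) ∨
      (A x y = -1 ∧ A y x = -3) ∨ (A x y = -3 ∧ A y x = -1) := by
  have h' := hA.neg_symm h
  have hinj : Set.InjOn (consSeq x fun _ ↦ y) (Finset.range 2) :=
    injOn_consSeq (m := 1) (by simp [Set.InjOn]) fun i hi ↦ (hA.ne_of_neg h).symm
  -- Weights p, q on the two vertices exclude edges with product of entries at least 4.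
  have key (p q : ℕ) (hp : 0 < p) (hq : 0 < q) (h1 : 2 * p + A x y * q ≤ 0)
      (h2 : A y x * p + 2 * q ≤ 0) : False := by
    refine hA.not_null (X := fun i j ↦ A (consSeq x (fun _ ↦ y) i) (consSeq x (fun _ ↦ y) j))
      hinj (fun i _ j _ ↦ le_rfl) [p, q] two_pos ⟨?_, ?_⟩
    · intro i hi
      interval_cases i <;> simpa
    · intro i hi
      interval_cases i <;> simp [Finset.sum_range_succ, consSeq, hA.diag] <;> lia
  by_cases hx1 : A x y = -1
  · by_cases hy : A y x ≤ -4
    · exact (key 1 2 (by lia) (by lia) (by lia) (by lia)).elim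
    · lia
  · by_cases hy1 : A y x = -1
    · by_cases hx : A x y ≤ -4
      · exact (key 2 1 (by lia) (by lia) (by lia) (by lia)).elim
      · lia
    · exact (key 1 1 (by lia) (by lia) (by lia) (by lia)).elim

end IsFiniteCartan

/-- `f 0, …, f (m - 1)` is a simply laced path in the diagram of `A`. -/
structure IsSimplePath {I : Type*} (A : I → I → ℤ) (f : ℕ → I) (m : ℕ) : Prop where
  injOn : Set.InjOn f (Finset.range m)
  adj (i : ℕ) : i + 1 < m → A (f i) (f (i + 1)) = -1 ∧ A (f (i + 1)) (f i) = -1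

/-! ### Simply laced paths and vertices attached to them. -/

namespace IsSimplePath

variable {I : Type*} {A : I → I → ℤ} {f : ℕ → I} {m : ℕ} (hf : IsSimplePath A f m)

include hf

lemma inj {i j : ℕ} (hi : i < m) (hj : j < m) (h : f i = f j) : i = j :=
  hf.injOn (by simpa using hi) (by simpa using hj) h

lemma neg_right {i : ℕ} (hi : i + 1 < m) : A (f i) (f (i + 1)) < 0 := by
  have := (hf.adj i hi).1
  lia

lemma neg_left {i : ℕ} (h0 : 0 < i) (hi : i < m) : A (f i) (f (i - 1)) < 0 := by
  obtain ⟨i, rfl⟩ : ∃ k, i = k + 1 := ⟨i - 1, by lia⟩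
  have := (hf.adj i hi).2
  simp
  lia

lemma shift {a k : ℕ} (h : a + k ≤ m) : IsSimplePath A (fun i ↦ f (a + i)) k where
  injOn i hi j hj hij := by
    have := hf.inj (i := a + i) (j := a + j) (by simp at hi; lia) (by simp at hj; lia) hij
    lia
  adj i hi := hf.adj (a + i) (by lia)

lemma reverse : IsSimplePath A (fun i ↦ f (m - 1 - i)) m where
  injOn i hi j hj hij := by
    simp only [Finset.coe_range, Set.mem_Iio] at hi hj
    have := hf.inj (i := m - 1 - i) (j := m - 1 - j) (by lia) (by lia) hij
    lia
  adj i hi := by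
    have := hf.adj (m - 1 - (i + 1)) (by lia)
    rw [show m - 1 - (i + 1) + 1 = m - 1 - i by lia] at this
    exact this.symm

lemma cons {v : I} (hv : ∀ i < m, f i ≠ v) (h : A v (f 0) = -1 ∧ A (f 0) v = -1) :
    IsSimplePath A (consSeq v f) (m + 1) where
  injOn := injOn_consSeq hf.injOn hv
  adj i hi := by
    rcases i with _ | i
    · exact h
    · exact hf.adj i (by lia)

variable [Fintype I] (hA : IsFiniteCartan A)

include hA

/-- A path cannot be closed to a cycle by one or two further vertices. -/
lemma not_closed {v v' : I} (hv : ∀ i < m, f i ≠ v) (hv' : ∀ i < m, f i ≠ v') {i j : ℕ}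
    (hij : i ≤ j) (hj : j < m) (hi' : A v (f i) < 0) (hj' : A v' (f j) < 0)
    (h : v = v' ∧ i < j ∨ A v v' < 0) : False := by
  classical
  have hmem (k : ℕ) (h1 : i ≤ k) (h2 : k ≤ j) : f k ∈ insert v (insert v'
      ((Finset.Icc i j).image f)) := by
    simp only [Finset.mem_insert, Finset.mem_image, Finset.mem_Icc]
    exact Or.inr (Or.inr ⟨k, ⟨h1, h2⟩, rfl⟩)
  refine hA.not_cycle (S := insert v (insert v' ((Finset.Icc i j).image f))) (by simp) fun x hx ↦ ?_
  rw [Finset.mem_insert, Finset.mem_insert] at hx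
  rcases hx with rfl | rfl | hx
  · rcases h with ⟨rfl, h⟩ | h
    · exact ⟨f i, hmem i le_rfl hij, f j, hmem j hij le_rfl,
        fun hfi ↦ h.ne (hf.inj (by lia) hj hfi), hi', hj'⟩
    · exact ⟨f i, hmem i le_rfl hij, v', by simp, hv' i (by lia), hi', h⟩
  · rcases h with ⟨rfl, h⟩ | h
    · exact ⟨f i, hmem i le_rfl hij, f j, hmem j hij le_rfl,
        fun hfi ↦ h.ne (hf.inj (by lia) hj hfi), hi', hj'⟩
    · exact ⟨f j, hmem j hij le_rfl, v, by simp, hv j hj, hj', hA.neg_symm h⟩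
  · obtain ⟨k, hk, rfl⟩ := Finset.mem_image.mp hx
    obtain ⟨h1, h2⟩ := Finset.mem_Icc.mp hk
    rcases h1.eq_or_lt with rfl | h1'
    · refine ⟨v, by simp, ?_⟩
      rcases h2.eq_or_lt with rfl | h2'
      · rcases h with ⟨-, h⟩ | h
        · exact absurd h (lt_irrefl _)
        · exact ⟨v', by simp, hA.ne_of_neg h, hA.neg_symm hi', hA.neg_symm hj'⟩
      · exact ⟨f (i + 1), hmem _ (by lia) h2', (hv _ (by lia)).symm, hA.neg_symm hi',
          hf.neg_right (by lia)⟩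
    · refine ⟨f (k - 1), hmem _ (by lia) (by lia), ?_⟩
      rcases h2.eq_or_lt with rfl | h2'
      · exact ⟨v', by simp, hv' _ (by lia), hf.neg_left (by lia) hj, hA.neg_symm hj'⟩
      · exact ⟨f (k + 1), hmem _ (by lia) h2', fun hfk ↦ by
          have := hf.inj (by lia) (by lia) hfk
          lia, hf.neg_left (by lia) (by lia), hf.neg_right (by lia)⟩

lemma adj_unique {v : I} (hv : ∀ i < m, f i ≠ v) {i j : ℕ} (hi : i < m) (hj : j < m)
    (hi' : A v (f i) < 0) (hj' : A v (f j) < 0) : i = j := by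
  rcases lt_trichotomy i j with h | h | h
  · exact (hf.not_closed hA hv hv h.le hj hi' hj' (.inl ⟨rfl, h⟩)).elim
  · exact h
  · exact (hf.not_closed hA hv hv h.le hi hj' hi' (.inl ⟨rfl, h⟩)).elim

lemma not_adj_of_adj {v v' : I} (hv : ∀ i < m, f i ≠ v) (hv' : ∀ i < m, f i ≠ v')
    (h : A v v' < 0) {i j : ℕ} (hi : i < m) (hj : j < m) (hi' : A v (f i) < 0) :
    A (f j) v' = 0 ∧ A v' (f j) = 0 := by
  have h0 : A v' (f j) = 0 := by
    by_contra h0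
    have hj' : A v' (f j) < 0 := lt_of_le_of_ne (hA.nonpos (hv' j hj).symm) h0
    rcases le_total i j with hij | hij
    · exact hf.not_closed hA hv hv' hij hj hi' hj' (.inr h)
    · exact hf.not_closed hA hv' hv hij hi hj' hi' (.inr (hA.neg_symm h))
  exact ⟨hA.zero_symm h0, h0⟩

lemma eq_pathCartan {i j : ℕ} (hi : i < m) (hj : j < m) : A (f i) (f j) = pathCartan i j := by
  have key (i j : ℕ) (hij : i < j) (hj : j < m) : A (f i) (f j) = pathCartan i j ∧
      A (f j) (f i) = pathCartan i j := by
    rw [pathCartan, if_neg hij.ne]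
    by_cases h : i + 1 = j
    · subst h
      simpa using hf.adj i hj
    · rw [if_neg (by lia)]
      have h0 : A (f i) (f j) = 0 := by
        by_contra h0
        have hneg : A (f i) (f j) < 0 :=
          lt_of_le_of_ne (hA.nonpos fun h ↦ hij.ne (hf.inj (by lia) hj h)) h0
        -- A chord from f i to f j would give f i two neighbours on the path starting at f (i + 1).
        have := (hf.shift (a := i + 1) (k := m - (i + 1)) (by lia)).adj_unique hA (v := f i)
          (fun k hk h ↦ by have := hf.inj (by lia) (by lia) h; lia)
          (i := 0) (j := j - (i + 1)) (by lia) (by lia) (hf.neg_right (by lia))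
          (by simpa [show i + 1 + (j - (i + 1)) = j by lia] using hneg)
        lia
      exact ⟨h0, hA.zero_symm h0⟩
  rcases lt_trichotomy i j with h | rfl | h
  · exact (key i j h hj).1
  · simp [pathCartan, hA.diag]
  · rw [(key j i h hi).2]
    simp only [pathCartan, eq_comm (a := j), or_comm]

lemma eq_forkCartan {v : I} (hv : ∀ i < m, f i ≠ v) {k : ℕ} (hk : k < m) {a c : ℤ}
    (ha : A v (f k) = -a) (hc : A (f k) v = -c) (h : A v (f k) < 0) {i j : ℕ}
    (hi : i < m + 1) (hj : j < m + 1) :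
    A (consSeq v f i) (consSeq v f j) = forkCartan k a c i j := by
  have h0 (i : ℕ) (hi : i < m) (hik : i ≠ k) : A v (f i) = 0 := by
    by_contra h0
    exact hik (hf.adj_unique hA hv hi hk (lt_of_le_of_ne (hA.nonpos (hv i hi).symm) h0) h)
  rcases i with _ | i <;> rcases j with _ | j
  · exact hA.diag v
  · simp only [consSeq, forkCartan]
    split_ifs with hjk
    · rw [hjk, ha]
    · exact h0 j (by lia) hjk
  · simp only [consSeq, forkCartan]
    split_ifs with hik
    · rw [hik, hc]
    · exact hA.zero_symm (h0 i (by lia) hik)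
  · exact hf.eq_pathCartan hA (by lia) (by lia)

/-- Joining `y` to the branch vertex `v` of a forked path. -/
lemma eq_tailCartan {v y : I} (hv : ∀ i < m, f i ≠ v) (hy : ∀ i < m, f i ≠ y) {k : ℕ}
    (hk : k < m) {a c : ℤ} (ha : A v (f k) = -a) (hc : A (f k) v = -c) (h : A v (f k) < 0)
    (hvy : A v y = -1 ∧ A y v = -1) {i j : ℕ} (hi : i < m + 2) (hj : j < m + 2) :
    A (consSeq y (consSeq v f) i) (consSeq y (consSeq v f) j) =
      tailCartan (forkCartan k a c) i j := by
  have h0 (j : ℕ) (hj : j < m) := hf.not_adj_of_adj hA hv hy (by lia) hk hj h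
  rcases i with _ | _ | i <;> rcases j with _ | _ | j
  · exact hA.diag y
  · exact hvy.2
  · exact (h0 j (by lia)).2
  · exact hvy.1
  · exact hA.diag v
  · exact hf.eq_forkCartan hA hv hk ha hc h (i := 0) (j := j + 1) (by lia) (by lia)
  · exact (h0 i (by lia)).1
  · exact hf.eq_forkCartan hA hv hk ha hc h (i := i + 1) (j := 0) (by lia) (by lia)
  · exact hf.eq_forkCartan hA hv hk ha hc h (i := i + 1) (j := j + 1) (by lia) (by lia)

end IsSimplePath

namespace IsFiniteCartan

variable {I : Type*} [Fintype I] {A : I → I → ℤ} (hA : IsFiniteCartan A)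

include hA

lemma not_hasEnd_self [DecidableEq I] {p : I} {S T : Finset I} (hS : HasEnd A p S)
    (hT : HasEnd A p T) (hST : Disjoint S T) (hpS : p ∉ S) (hpT : p ∉ T) : False :=
  hA.not_hasEnd_hasEnd (f := fun _ ↦ p) (le_refl 0) (by simp [Set.InjOn]) (by lia) hS hT hST
    (fun _ _ _ ↦ hpS) fun _ _ _ ↦ hpT

lemma not_hasEnd_adj [DecidableEq I] {p q : I} (hpq : A p q < 0) {S T : Finset I}
    (hS : HasEnd A p S) (hT : HasEnd A q T) (hST : Disjoint S T) (hpS : p ∉ S) (hqS : q ∉ S)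
    (hpT : p ∉ T) (hqT : q ∉ T) : False := by
  have h (i : ℕ) (hi : i ≤ 1) : consSeq p (fun _ ↦ q) i = p ∨ consSeq p (fun _ ↦ q) i = q := by
    interval_cases i <;> simp [consSeq]
  refine hA.not_hasEnd_hasEnd (f := consSeq p fun _ ↦ q) zero_le_one ?_ ?_ hS hT hST ?_ ?_
  · exact (injOn_consSeq (m := 1) (by simp [Set.InjOn]) fun i hi ↦ (hA.ne_of_neg hpq).symm).mono
      fun i hi ↦ by simp at hi ⊢; lia
  · intro i h1 h2
    interval_cases i
    exact hpq
  · intro i _ hi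
    rcases h i hi with h | h <;> rw [h] <;> assumption
  · intro i _ hi
    rcases h i hi with h | h <;> rw [h] <;> assumption

/-- A proper nonempty subset of a connected diagram is adjacent to its complement. -/
lemma exists_adj_of_not_forall
    (hconn : ∀ p : I → Prop, (∃ i, p i) → (∀ i j, p i → A j i ≠ 0 → p j) → ∀ j, p j)
    {p : I → Prop} (hp : ∃ i, p i) (hp' : ¬ ∀ i, p i) : ∃ x y, p x ∧ ¬ p y ∧ A y x < 0 := by
  by_contra! h
  refine hp' (hconn p hp fun x y hx hxy ↦ ?_)
  by_contra hy
  exact hxy (le_antisymm (hA.nonpos (by rintro rfl; exact hy hx)) (h x y hx hy))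

end IsFiniteCartan

/-- The Cartan matrices of finite type of rank `n`. -/
def IsDynkin (n : ℕ) (X : ℕ → ℕ → ℤ) : Prop :=
  n = 2 ∨ X = forkCartan 0 1 1 ∨ 3 ≤ n ∧ X = forkCartan 0 1 2 ∨ 3 ≤ n ∧ X = forkCartan 0 2 1 ∨
    4 ≤ n ∧ X = forkCartan 1 1 1 ∨ n ∈ ({6, 7, 8} : Finset ℕ) ∧ X = forkCartan 2 1 1 ∨
    n = 4 ∧ X = f4Cartan

/-- The vertices of the diagram of `A` can be numbered so that `A` becomes a standard matrix. -/
def HasDynkin {I : Type*} (A : I → I → ℤ) : Prop :=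
  ∃ (n : ℕ) (g : ℕ → I) (X : ℕ → ℕ → ℤ), Set.InjOn g (Finset.range n) ∧ (∀ x, ∃ i < n, g i = x) ∧
    (∀ i < n, ∀ j < n, A (g i) (g j) = X i j) ∧ IsDynkin n X

/-! ### Diagrams around a longest simply laced path. -/

namespace IsSimplePath

variable {I : Type*} {A : I → I → ℤ} {f : ℕ → I} {m : ℕ}

lemma single (A : I → I → ℤ) (v : I) : IsSimplePath A (fun _ ↦ v) 1 where
  injOn := by simp [Set.InjOn]
  adj i hi := by lia

variable (hf : IsSimplePath A f m)

include hf

section Maximal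

variable (hmax : ∀ g, ¬ IsSimplePath A g (m + 1))

include hmax

lemma interior_of_adj {v : I} (hv : ∀ i < m, f i ≠ v) {j : ℕ} (hj : j < m)
    (h : A (f j) v = -1 ∧ A v (f j) = -1) : 0 < j ∧ j + 1 < m := by
  constructor
  · by_contra h0
    obtain rfl : j = 0 := by lia
    exact hmax _ (hf.cons hv h.symm)
  · by_contra h0
    obtain rfl : j = m - 1 := by lia
    exact hmax _ (hf.reverse.cons (fun i hi ↦ hv _ (by lia)) (by simpa using h.symm))

end Maximal

variable [Fintype I] (hA : IsFiniteCartan A)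

include hA

lemma not_hasEnd [DecidableEq I] {i j : ℕ} (hij : i ≤ j) (hj : j < m) {S T : Finset I}
    (hS : IsFiniteCartan.HasEnd A (f i) S) (hT : IsFiniteCartan.HasEnd A (f j) T)
    (hST : Disjoint S T) (hfS : ∀ k, i ≤ k → k ≤ j → f k ∉ S)
    (hfT : ∀ k, i ≤ k → k ≤ j → f k ∉ T) : False :=
  hA.not_hasEnd_hasEnd hij (hf.injOn.mono fun k hk ↦ by simp at hk ⊢; lia)
    (fun k _ hk ↦ hf.neg_right (by lia)) hS hT hST hfS hfT

/-- The two neighbours of an interior vertex of a path form an affine end. -/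
lemma hasEnd_neighbours [DecidableEq I] {k : ℕ} (h0 : 0 < k) (hk : k + 1 < m) :
    IsFiniteCartan.HasEnd A (f k) {f (k - 1), f (k + 1)} :=
  hA.hasEnd_pair (fun h ↦ by have := hf.inj (by lia) (by lia) h; lia)
    (hf.neg_left h0 (by lia)) (hf.neg_right hk)

lemma ne_neighbours [DecidableEq I] {k : ℕ} (h0 : 0 < k) (hk : k + 1 < m) :
    f k ∉ ({f (k - 1), f (k + 1)} : Finset I) := by
  simp only [Finset.mem_insert, Finset.mem_singleton, not_or]
  exact ⟨hA.ne_of_neg (hf.neg_left h0 (by lia)), hA.ne_of_neg (hf.neg_right hk)⟩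

/-- Otherwise the two path neighbours and the multiple edge would be affine ends at the same vertex.
-/
lemma not_multi_interior {v : I} (hv : ∀ i < m, f i ≠ v) {k : ℕ} (h0 : 0 < k) (hk : k + 1 < m)
    (h : A (f k) v < 0) : A (f k) v = -1 ∧ A v (f k) = -1 := by
  classical
  by_contra hmul
  refine hA.not_hasEnd_self (hf.hasEnd_neighbours hA h0 hk) (hA.hasEnd_singleton h hmul) ?_
    (hf.ne_neighbours hA h0 hk) (by simpa using hv k (by lia))
  simp [hv (k - 1) (by lia), hv (k + 1) hk, eq_comm (a := v)]

section Maximal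

variable (hmax : ∀ g, ¬ IsSimplePath A g (m + 1))

include hmax

/-- The multiple edge at f 0 is one affine end. If y is joined by a simple edge, maximality makes f
j interior and y, f (j + 1) form the other; a multiple edge to y is an end itself. -/
lemma not_adj_of_multi {v y : I} (hv : ∀ i < m, f i ≠ v) (hy : ∀ i < m, f i ≠ y) (hvy : v ≠ y)
    (h : A (f 0) v < 0) (hmul : ¬ (A (f 0) v = -1 ∧ A v (f 0) = -1)) {j : ℕ} (hj : j < m)
    (hyj : A (f j) y < 0) : False := by
  classical
  by_cases hs : A (f j) y = -1 ∧ A y (f j) = -1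
  · obtain ⟨h1, h2⟩ := hf.interior_of_adj hmax hy hj hs
    refine hf.not_hasEnd hA j.zero_le hj (hA.hasEnd_singleton h hmul)
      (hA.hasEnd_pair (hy (j + 1) h2).symm hyj (hf.neg_right h2)) ?_ ?_ ?_
    · simp [hvy, (hv (j + 1) h2).symm]
    · intro k _ hk
      simpa using hv k (by lia)
    · intro k _ hk
      simp only [Finset.mem_insert, Finset.mem_singleton, not_or]
      exact ⟨hy k (by lia), fun h ↦ by have := hf.inj (by lia) h2 h; lia⟩
  · refine hf.not_hasEnd hA j.zero_le hj (hA.hasEnd_singleton h hmul)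
      (hA.hasEnd_singleton hyj hs) (by simpa using hvy) ?_ ?_
    · intro k _ hk
      simpa using hv k (by lia)
    · intro k _ hk
      simpa using hy k (by lia)

end Maximal

lemma not_adj_of_adj_lt {v y : I} (hv : ∀ i < m, f i ≠ v) (hy : ∀ i < m, f i ≠ y) (hvy : v ≠ y)
    {i j : ℕ} (hi : 0 < i) (hij : i < j) (hj : j + 1 < m) (h : A (f i) v < 0)
    (h' : A (f j) y < 0) : False := by
  classical
  refine hf.not_hasEnd hA hij.le (by lia)
    (hA.hasEnd_pair (hv (i - 1) (by lia)).symm h (hf.neg_left hi (by lia)))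
    (hA.hasEnd_pair (hy (j + 1) hj).symm h' (hf.neg_right hj)) ?_ ?_ ?_
  · have h1 : f (i - 1) ≠ f (j + 1) := fun h ↦ by have := hf.inj (by lia) hj h; lia
    simp [hvy.symm, hv (j + 1) hj, h1.symm, (hy (i - 1) (by lia)).symm]
  · intro k _ hk
    simp only [Finset.mem_insert, Finset.mem_singleton, not_or]
    exact ⟨hv k (by lia), fun h ↦ by have := hf.inj (by lia) (by lia) h; lia⟩
  · intro k _ hk
    simp only [Finset.mem_insert, Finset.mem_singleton, not_or]
    exact ⟨hy k (by lia), fun h ↦ by have := hf.inj (by lia) hj h; lia⟩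

lemma not_null_fork {v : I} (hv : ∀ i < m, f i ≠ v) {k : ℕ} (hk : k < m) {a c : ℤ}
    (ha : A v (f k) = -a) (hc : A (f k) v = -c) (ha0 : 0 < a) (w : List ℕ) {n : ℕ}
    (hn : 0 < n) (hnm : n ≤ m + 1) : ¬ ((∀ i < n, 0 < w.getD i 0) ∧
      ∀ i < n, ∑ j ∈ Finset.range n, forkCartan k a c i j * w.getD j 0 ≤ 0) := fun hw ↦
  hA.not_null ((injOn_consSeq hf.injOn hv).mono fun i hi ↦ by simp at hi ⊢; lia)
    (fun i hi j hj ↦ (hf.eq_forkCartan hA hv hk ha hc (by lia) (by lia) (by lia)).le) w hn hw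

omit [Fintype I] hA in
lemma injOn_tail {v y : I} (hv : ∀ i < m, f i ≠ v) (hy : ∀ i < m, f i ≠ y) (hvy : v ≠ y) :
    Set.InjOn (consSeq y (consSeq v f)) (Finset.range (m + 2)) :=
  injOn_consSeq (injOn_consSeq hf.injOn hv) (by
    rintro (_ | i) hi
    · exact hvy
    · exact hy i (by lia))

lemma not_null_tail {v y : I} (hv : ∀ i < m, f i ≠ v) (hy : ∀ i < m, f i ≠ y) {k : ℕ} (hk : k < m)
    {a c : ℤ} (ha : A v (f k) = -a) (hc : A (f k) v = -c) (ha0 : 0 < a)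
    (hvy : A v y = -1 ∧ A y v = -1) (w : List ℕ) {n : ℕ}
    (hn : 0 < n) (hnm : n ≤ m + 2) : ¬ ((∀ i < n, 0 < w.getD i 0) ∧
      ∀ i < n, ∑ j ∈ Finset.range n, tailCartan (forkCartan k a c) i j * w.getD j 0 ≤ 0) :=
  fun hw ↦ hA.not_null ((hf.injOn_tail hv hy (hA.ne_of_neg (by lia))).mono
      fun i hi ↦ by simp at hi ⊢; lia)
    (fun i hi j hj ↦ (hf.eq_tailCartan hA hv hy hk ha hc (by lia) hvy (by lia) (by lia)).le)
    w hn hw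

/-- The vectors [1, 2, 1] and [3, 2, 1] are the null vectors of the two affine extensions of a
triple edge by one simple edge. -/
lemma not_triple {v : I} (hv : ∀ i < m, f i ≠ v) (hm : 2 ≤ m) (h : A v (f 0) < 0)
    (hmul : ¬ (A v (f 0) = -1 ∧ A (f 0) v = -1)) :
    (A v (f 0) = -1 ∧ A (f 0) v = -2) ∨ (A v (f 0) = -2 ∧ A (f 0) v = -1) := by
  rcases hA.edge_cases h with h | h | h | h | h
  · exact (hmul h).elim
  · exact .inl h
  · exact .inr h
  · exact (hf.not_null_fork hA hv (by lia) (a := 1) (c := 3) h.1 h.2 (by lia) [1, 2, 1] (n := 3)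
      (by lia) (by lia) (by decide)).elim
  · exact (hf.not_null_fork hA hv (by lia) (a := 3) (c := 1) h.1 h.2 (by lia) [3, 2, 1] (n := 3)
      (by lia) (by lia) (by decide)).elim

end IsSimplePath

namespace IsSimplePath

variable {I : Type*} [Fintype I] {A : I → I → ℤ} {f : ℕ → I} {m : ℕ} (hf : IsSimplePath A f m)
  (hA : IsFiniteCartan A) (hmax : ∀ g, ¬ IsSimplePath A g (m + 1))
  (hconn : ∀ p : I → Prop, (∃ i, p i) → (∀ i j, p i → A j i ≠ 0 → p j) → ∀ j, p j)

include hf hA hmax hconn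

/-- A diagram with a multiple edge at the end of a maximal path. -/
lemma hasDynkin_of_multi (hm : 0 < m) {v : I} (hv : ∀ i < m, f i ≠ v) (h : A v (f 0) < 0)
    (hmul : ¬ (A v (f 0) = -1 ∧ A (f 0) v = -1)) : HasDynkin A := by
  classical
  have h' := hA.neg_symm h
  have hmul' : ¬ (A (f 0) v = -1 ∧ A v (f 0) = -1) := fun h ↦ hmul h.symm
  by_cases hall : ∀ x, x = v ∨ ∃ i < m, f i = x
  · have hall' : ∀ x, ∃ i < m + 1, consSeq v f i = x := fun x ↦ by
      rcases hall x with rfl | ⟨i, hi, rfl⟩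
      · exact ⟨0, by lia, rfl⟩
      · exact ⟨i + 1, by lia, rfl⟩
    rcases (show m = 1 ∨ 2 ≤ m by lia) with rfl | hm2
    · exact ⟨2, consSeq v f, _, injOn_consSeq hf.injOn hv, hall', fun _ _ _ _ ↦ rfl, .inl rfl⟩
    · rcases hf.not_triple hA hv hm2 h hmul with ⟨h1, h2⟩ | ⟨h1, h2⟩
      · exact ⟨m + 1, consSeq v f, forkCartan 0 1 2, injOn_consSeq hf.injOn hv, hall',
          fun i hi j hj ↦ hf.eq_forkCartan hA hv hm h1 h2 h hi hj,
          .inr (.inr (.inl ⟨by lia, rfl⟩))⟩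
      · exact ⟨m + 1, consSeq v f, forkCartan 0 2 1, injOn_consSeq hf.injOn hv, hall',
          fun i hi j hj ↦ hf.eq_forkCartan hA hv hm h1 h2 h hi hj,
          .inr (.inr (.inr (.inl ⟨by lia, rfl⟩)))⟩
  obtain ⟨x, y, hx, hy, hyx⟩ := hA.exists_adj_of_not_forall hconn ⟨v, .inl rfl⟩ hall
  push Not at hy
  obtain ⟨hyv, hy⟩ := hy
  rcases hx with rfl | ⟨j, hj, rfl⟩
  swap
  · exact (hf.not_adj_of_multi hA hmax hv hy hyv.symm h' hmul' hj (hA.neg_symm hyx)).elim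
  have hxy := hA.neg_symm hyx
  have hs : A x y = -1 ∧ A y x = -1 := by
    by_contra hs
    exact hA.not_hasEnd_self (hA.hasEnd_singleton h hmul) (hA.hasEnd_singleton hxy hs)
      (by simpa using hy 0 hm) (by simpa using (hv 0 hm).symm) (by simpa using hyv.symm)
  rcases (show m = 1 ∨ 2 ≤ m by lia) with rfl | hm2
  · exact (hmax _ ((single A y).cons (fun i hi ↦ hyv) hs)).elim
  have h12 := hf.not_triple hA hv hm2 h hmul
  rcases (show 3 ≤ m ∨ m = 2 by lia) with hm3 | rfl
  · rcases h12 with ⟨h1, h2⟩ | ⟨h1, h2⟩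
    -- A double edge with a simple edge on one side and two on the other is affine; this and the
    -- next vector are the null vectors for the two orientations.
    · exact (hf.not_null_tail hA hv hy hm (a := 1) (c := 2) h1 h2 (by lia) hs [1, 2, 3, 2, 1]
        (n := 5) (by lia) (by lia) (by decide)).elim
    · exact (hf.not_null_tail hA hv hy hm (a := 2) (c := 1) h1 h2 (by lia) hs [2, 4, 3, 2, 1]
        (n := 5) (by lia) (by lia) (by decide)).elim
  by_cases hall2 : ∀ z, z = y ∨ z = x ∨ ∃ i < 2, f i = z
  · have hall' : ∀ z, ∃ i < 4, consSeq y (consSeq x f) i = z := fun z ↦ by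
      rcases hall2 z with rfl | rfl | ⟨i, hi, rfl⟩
      · exact ⟨0, by lia, rfl⟩
      · exact ⟨1, by lia, rfl⟩
      · exact ⟨i + 2, by lia, rfl⟩
    have hinj := hf.injOn_tail hv hy hyv.symm
    rcases h12 with ⟨h1, h2⟩ | ⟨h1, h2⟩
    · refine ⟨4, consSeq y (consSeq x f), f4Cartan, hinj, hall', fun i hi j hj ↦ ?_, by
        simp [IsDynkin]⟩
      rw [hf.eq_tailCartan hA hv hy hm (a := 1) (c := 2) h1 h2 h hs hi hj]
      revert i j
      decide
    -- The double edge points the other way, so the numbering is reversed to match `f4Cartan`.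
    · refine ⟨4, fun i ↦ consSeq y (consSeq x f) (3 - i), f4Cartan, ?_, fun z ↦ ?_,
        fun i hi j hj ↦ ?_, by simp [IsDynkin]⟩
      · intro i hi j hj hij
        simp only [Finset.coe_range, Set.mem_Iio] at hi hj
        have := hinj (by simp; lia) (by simp; lia) hij
        lia
      · obtain ⟨i, hi, hz⟩ := hall' z
        exact ⟨3 - i, by lia, by simpa [show 3 - (3 - i) = i by lia] using hz⟩
      · rw [hf.eq_tailCartan hA hv hy hm (a := 2) (c := 1) h1 h2 h hs (by lia) (by lia)]
        revert i j
        decide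
  obtain ⟨w, z, hw, hz, hzw⟩ := hA.exists_adj_of_not_forall hconn ⟨y, .inl rfl⟩ hall2
  push Not at hz
  obtain ⟨hzy, hzx, hz⟩ := hz
  have hwz := hA.neg_symm hzw
  exfalso
  rcases hw with rfl | rfl | ⟨j, hj, rfl⟩
  · by_cases hs' : A z w = -1 ∧ A w z = -1
    -- The vertices z, y, x form a simply laced path longer than the maximal length 2.
    · refine hmax _ (((single A x).cons (v := w) (fun i hi ↦ hyv.symm) hs.symm).cons (v := z) ?_ hs')
      intro i hi
      interval_cases i
      · exact hzy.symm
      · exact hzx.symm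
    · refine hA.not_hasEnd_adj hxy (hA.hasEnd_singleton h hmul)
        (hA.hasEnd_singleton hwz fun h ↦ hs' h.symm) ?_ ?_ ?_ ?_ ?_
      · simpa using hz 0 hm
      · simpa using (hv 0 hm).symm
      · simpa using (hy 0 hm).symm
      · simpa using hzx.symm
      · simpa using hzy.symm
  · refine hA.not_hasEnd_self (hA.hasEnd_singleton h hmul) (hA.hasEnd_pair hzy.symm hxy hwz)
      ?_ ?_ ?_
    · simp [hy 0 hm, hz 0 hm]
    · simpa using (hv 0 hm).symm
    · simp [hyv.symm, hzx.symm]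
  · exact hf.not_adj_of_multi hA hmax hv hz hzx.symm h' hmul' hj hwz

/-- A simply laced branching off a maximal path. -/
lemma hasDynkin_of_simple {v : I} (hv : ∀ i < m, f i ≠ v) {k : ℕ} (hk : 0 < k) (hkm : 2 * k < m)
    (h : A (f k) v < 0)
    (hs : ∀ v, (∀ i < m, f i ≠ v) → ∀ j < m, A (f j) v < 0 → A (f j) v = -1 ∧ A v (f j) = -1) :
    HasDynkin A := by
  classical
  have hk' : k + 1 < m := by lia
  obtain ⟨h2, h1⟩ := hs v hv k (by lia) h
  have h' := hA.neg_symm h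
  have hall : ∀ x, x = v ∨ ∃ i < m, f i = x := by
    by_contra hall
    obtain ⟨x, y, hx, hy, hyx⟩ := hA.exists_adj_of_not_forall hconn ⟨v, .inl rfl⟩ hall
    push Not at hy
    obtain ⟨hyv, hy⟩ := hy
    have hxy := hA.neg_symm hyx
    rcases hx with rfl | ⟨j, hj, rfl⟩
    · by_cases hs' : A x y = -1 ∧ A y x = -1
      · rcases (show k = 1 ∨ 2 ≤ k by lia) with rfl | hk2
        -- Replacing f 0 by the two vertices y, v lengthens the path.
        · refine hmax _ (IsSimplePath.cons (v := y) (f := consSeq x fun i ↦ f (1 + i))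
            (m := m) ?_ ?_ hs'.symm)
          · rw [show m = m - 1 + 1 by lia]
            exact (hf.shift (a := 1) (k := m - 1) (by lia)).cons (fun i hi ↦ hv _ (by lia)) ⟨h1, h2⟩
          · rintro (_ | i) hi
            · exact hyv.symm
            · exact hy _ (by lia)
        -- Three arms of length 2: the affine diagram of E₆.
        · refine (hf.shift (a := k - 2) (k := 5) (by lia)).not_null_tail hA
            (fun i hi ↦ hv _ (by lia)) (fun i hi ↦ hy _ (by lia)) (k := 2) (by lia) (a := 1) (c := 1)
            ?_ ?_ (by lia) hs' [1, 2, 1, 2, 3, 2, 1] (n := 7) (by lia) (by lia) (by decide)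
          · rwa [show k - 2 + 2 = k by lia]
          · rwa [show k - 2 + 2 = k by lia]
      · refine hA.not_hasEnd_adj h (hf.hasEnd_neighbours hA hk hk')
          (hA.hasEnd_singleton hxy hs') ?_ (hf.ne_neighbours hA hk hk') ?_ ?_ ?_
        · simp [(hy (k - 1) (by lia)).symm, (hy (k + 1) hk').symm]
        · simp [(hv (k - 1) (by lia)).symm, (hv (k + 1) hk').symm]
        · simpa using hy k (by lia)
        · simpa using hyv.symm
    · obtain ⟨hj1, hj2⟩ := hf.interior_of_adj hmax hy hj (hs y hy j hj hxy)
      -- Two branch vertices or a vertex with four neighbours: affine diagrams of type D.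
      rcases lt_trichotomy k j with hkj | rfl | hkj
      · exact hf.not_adj_of_adj_lt hA hv hy hyv.symm hk hkj hj2 h hxy
      · refine hA.not_hasEnd_self (hf.hasEnd_neighbours hA hk hk')
          (hA.hasEnd_pair hyv.symm h hxy) ?_ (hf.ne_neighbours hA hk hk') ?_
        · simp [(hy (k - 1) (by lia)).symm, (hy (k + 1) hk').symm, (hv (k - 1) (by lia)).symm,
            (hv (k + 1) hk').symm]
        · simp [hv k hj, hy k hj]
      · exact hf.not_adj_of_adj_lt hA hy hv hyv hj1 hkj hk' hxy h
  refine ⟨m + 1, consSeq v f, forkCartan k 1 1, injOn_consSeq hf.injOn hv, fun x ↦ ?_,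
    fun i hi j hj ↦ hf.eq_forkCartan hA hv (by lia) h1 h2 h' hi hj, ?_⟩
  · rcases hall x with rfl | ⟨i, hi, rfl⟩
    · exact ⟨0, by lia, rfl⟩
    · exact ⟨i + 1, by lia, rfl⟩
  -- The arms now have lengths 1, k and m - 1 - k ≥ k. For k = 2 and m ≥ 8 there is an affine E₈,
  -- for k ≥ 3 an affine E₇.
  rcases (show k = 1 ∨ k = 2 ∨ 3 ≤ k by lia) with rfl | rfl | hk3
  · exact .inr (.inr (.inr (.inr (.inl ⟨by lia, rfl⟩))))
  · rcases (show m = 5 ∨ m = 6 ∨ m = 7 ∨ 8 ≤ m by lia) with rfl | rfl | rfl | hm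
    · simp [IsDynkin]
    · simp [IsDynkin]
    · simp [IsDynkin]
    · exact (hf.not_null_fork hA hv (by lia) (a := 1) (c := 1) h1 h2 (by lia)
        [3, 2, 4, 6, 5, 4, 3, 2, 1] (n := 9) (by lia) (by lia) (by decide)).elim
  · refine ((hf.shift (a := k - 3) (k := 7) (by lia)).not_null_fork hA
      (fun i hi ↦ hv _ (by lia)) (k := 3) (by lia) (a := 1) (c := 1) ?_ ?_ (by lia)
      [2, 1, 2, 3, 4, 3, 2, 1] (n := 8) (by lia) (by lia) (by decide)).elim
    · rwa [show k - 3 + 3 = k by lia]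
    · rwa [show k - 3 + 3 = k by lia]

end IsSimplePath

/-- A connected Cartan matrix of finite type is one of the standard ones. -/
theorem IsFiniteCartan.hasDynkin {I : Type*} [Fintype I] [Nonempty I] {A : I → I → ℤ}
    (hA : IsFiniteCartan A)
    (hconn : ∀ p : I → Prop, (∃ i, p i) → (∀ i j, p i → A j i ≠ 0 → p j) → ∀ j, p j) :
    HasDynkin A := by
  classical
  -- A longest path exists because its vertices are distinct and the diagram is finite.
  obtain ⟨m, f, hm, hf, hmax⟩ : ∃ m f, 0 < m ∧ IsSimplePath A f m ∧
      ∀ g, ¬ IsSimplePath A g (m + 1) := by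
    by_contra! h
    have key (m : ℕ) : ∃ f, IsSimplePath A f (m + 1) := by
      induction m with
      | zero => exact ⟨_, IsSimplePath.single A (Classical.arbitrary I)⟩
      | succ m ih =>
        obtain ⟨f, hf⟩ := ih
        exact h _ f m.succ_pos hf
    obtain ⟨f, hf⟩ := key (Fintype.card I)
    have := Finset.card_le_card_of_injOn f (s := Finset.range (Fintype.card I + 1))
      (t := Finset.univ) (by simp) hf.injOn
    simp at this
  have hrev (v : I) (j : ℕ) (hv : ∀ i < m, f i ≠ v) : ∀ i < m, f (m - 1 - i) ≠ v :=
    fun i hi ↦ hv _ (by lia)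
  by_cases hall : ∀ x, ∃ i < m, f i = x
  · refine ⟨m, f, forkCartan 0 1 1, hf.injOn, hall, fun i hi j hj ↦ ?_, .inr (.inl rfl)⟩
    rw [hf.eq_pathCartan hA hi hj]
    rcases i with _ | i <;> rcases j with _ | j <;> simp [forkCartan, pathCartan, eq_comm]
  by_cases hs : ∀ v, (∀ i < m, f i ≠ v) → ∀ j < m, A (f j) v < 0 → A (f j) v = -1 ∧ A v (f j) = -1
  · obtain ⟨x, v, ⟨k, hk, rfl⟩, hv, hvk⟩ := hA.exists_adj_of_not_forall hconn ⟨f 0, 0, hm, rfl⟩ hall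
    push Not at hv
    have h := hA.neg_symm hvk
    obtain ⟨hk1, hk2⟩ := hf.interior_of_adj hmax hv hk (hs v hv k hk h)
    -- Reversing the path if necessary makes the arm before the branch vertex the shorter one.
    rcases (show 2 * k < m ∨ 2 * (m - 1 - k) < m by lia) with hkm | hkm
    · exact hf.hasDynkin_of_simple hA hmax hconn hv hk1 hkm h hs
    · refine hf.reverse.hasDynkin_of_simple hA hmax hconn (fun i hi ↦ hv _ (by lia)) (by lia) hkm
        (by rwa [show m - 1 - (m - 1 - k) = k by lia]) fun v hv j hj hjv ↦ hs v ?_ _ (by lia) hjv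
      intro i hi
      have := hv (m - 1 - i) (by lia)
      rwa [show m - 1 - (m - 1 - i) = i by lia] at this
  · push Not at hs
    obtain ⟨v, hv, k, hk, hkv, hmul⟩ := hs
    have hmul' : ¬ (A v (f k) = -1 ∧ A (f k) v = -1) := fun h ↦ hmul h.2 h.1
    have hvk := hA.neg_symm hkv
    rcases (show k = 0 ∨ k = m - 1 ∨ 0 < k ∧ k + 1 < m by lia) with rfl | rfl | ⟨h1, h2⟩
    · exact hf.hasDynkin_of_multi hA hmax hconn hm hv hvk hmul'
    · exact hf.reverse.hasDynkin_of_multi hA hmax hconn hm (fun i hi ↦ hv _ (by lia))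
        (by simpa using hvk) (by simpa using hmul')
    · have := hf.not_multi_interior hA hv h1 h2 hkv
      exact (hmul this.1 this.2).elim

namespace RootPairing.Base

variable {ι M N : Type*} [AddCommGroup M] [Module ℝ M] [AddCommGroup N] [Module ℝ N]
  {P : RootPairing ι ℝ M N} (b : P.Base)

/-- A positive diagonal D makes DA positive definite. If (Au)_i ≤ 0 wherever u_i > 0, then uᵀDAu
would be ≤ 0. -/
lemma isFiniteCartan [Finite ι] [P.IsRootSystem] [P.IsCrystallographic] :
    IsFiniteCartan fun i j : b.support ↦ P.pairingIn ℤ i j := by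
  classical
  refine ⟨fun i ↦ b.cartanMatrix_apply_same i, fun {i j} hij ↦ b.cartanMatrix_le_zero_of_ne i j hij,
    fun {i j} h ↦ b.cartanMatrix_apply_eq_zero_iff_symm.mp h, fun u hu hu0 ↦ ?_⟩
  obtain ⟨d, hd0, hd⟩ := b.exists_cartanMatrix_diagaonal_mul_posDef
  by_contra! h
  refine absurd (hd.dotProduct_mulVec_pos hu0) (not_lt.mpr ?_)
  rw [← Matrix.mulVec_mulVec]
  refine Finset.sum_nonpos fun i _ ↦ ?_
  rw [Matrix.mulVec_diagonal, Pi.star_apply, star_trivial]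
  rcases (hu i).eq_or_lt with h0 | h0
  · rw [← h0, zero_mul]
  · exact mul_nonpos_of_nonneg_of_nonpos h0.le (mul_nonpos_of_nonneg_of_nonpos (hd0 i).le (h i h0))

theorem attainsInterval_univ [Fintype ι] [P.IsRootSystem] [P.IsCrystallographic] [P.IsReduced]
    [P.IsIrreducible] (h2 : b.support.card ≠ 2) : b.AttainsInterval Finset.univ := by
  classical
  have : Nonempty ι := by
    by_contra h
    rw [not_nonempty_iff] at h
    have h1 := IsRootSystem.span_root_eq_top (P := P)
    have := IsIrreducible.nontrivial (P := P)
    rw [Set.range_eq_empty, Submodule.span_empty] at h1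
    exact bot_ne_top h1
  have : Nonempty b.support := b.support_nonempty.to_subtype
  obtain ⟨n, g, X, hinj, hg, hX, hn⟩ := b.isFiniteCartan.hasDynkin
    fun p hp h j ↦ hp.elim fun i hi ↦ b.induction_on_cartanMatrix p hi h
  have hs : b.HasShape g n X := ⟨hinj, hX⟩
  have hu : (Finset.range n).image g = Finset.univ := by
    ext x
    simpa using hg x
  have hc : b.support.card = n := by
    rw [← Fintype.card_coe, ← Finset.card_univ, ← hu, Finset.card_image_of_injOn hinj,
      Finset.card_range]
  rw [← hu]
  rw [hc] at h2
  have hn0 : 0 < n := hc ▸ b.support_nonempty.card_pos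
  rcases hn with h | rfl | ⟨h, rfl⟩ | ⟨h, rfl⟩ | ⟨h, rfl⟩ | ⟨h, rfl⟩ | ⟨rfl, rfl⟩
  · exact absurd h h2
  · rcases (show n = 1 ∨ 3 ≤ n by lia) with rfl | hn
    · exact hs.attainsInterval_one
    · exact hs.attainsInterval_A hn
  · exact hs.attainsInterval_B h
  · exact hs.attainsInterval_C h
  · exact hs.attainsInterval_D h
  · simp only [Finset.mem_insert, Finset.mem_singleton] at h
    rcases h with rfl | rfl | rfl
    · exact hs.attainsInterval_E6
    · exact hs.attainsInterval_E7
    · exact hs.attainsInterval_E8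
  · exact hs.attainsInterval_F4

end RootPairing.Base

theorem mainTheorem1 {ι M N : Type*} [Fintype ι]
    [AddCommGroup M] [Module ℝ M] [AddCommGroup N] [Module ℝ N]
    (P : RootPairing ι ℝ M N)
    [P.IsRootSystem] [P.IsCrystallographic] [P.IsReduced] [P.IsIrreducible]
    (b : P.Base) (w₀ : P.weylGroup) (hw₀ : b.IsLongest w₀) :
    Set.MapsTo b.atomicLength Set.univ (Set.Icc 0 (b.atomicLength w₀)) ∧
      (Set.SurjOn b.atomicLength Set.univ (Set.Icc 0 (b.atomicLength w₀)) ↔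
        b.support.card ≠ 2) := by
  rw [hw₀.atomicLength_eq]
  refine ⟨fun w _ ↦ ⟨b.atomicLength_nonneg w, b.atomicLength_le_heightSum_univ w⟩, ?_, ?_⟩
  · intro hsurj h2
    obtain ⟨w, -, hw⟩ := hsurj ⟨zero_le_two, b.two_le_heightSum_univ h2⟩
    exact b.atomicLength_ne_two_of_card_eq_two h2 w hw
  · intro h2 z hz
    obtain ⟨w, -, hw⟩ := b.attainsInterval_univ h2 z hz.1 hz.2
    exact ⟨w, Set.mem_univ _, hw⟩
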